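/- **Setting.** Let $\Omega\subset\mathbb R^d$ be open, $T>0$, $Q:=\Omega\times(0,T)$, and let $u:Q\to\mathbb R^d$ be a measurable vector field. $O\subset\subset\Omega$ means that $O$ is open and $\overline O$ is a compact subset of $\Omega$ (similarly $I\subset\subset(0,T)$). $B_1$ is the open unit ball centred at the origin. For $1<q<\infty$, $\theta\in(0,1)$, $B^{\theta}_{q,\infty}(O)$ is the space with norm $\|f\|_{L^q(O)}+\sup_{h\neq0}|h|^{-\theta}\|f(\cdot+h)-f\|_{L^q(O\cap(O-h))}$; $BV(O)$ has norm $\|f\|_{L^1(O)}+|\nabla f|(O)$. $p'=p/(p-1)$ is the conjugate exponent. $\mathcal M_{\rm loc}(Q;\mathbb R^m)$ is the space of $\mathbb R^m$-valued Radon measures on $Q$, $\|\mu\|_{\mathcal M(K)}=|\mu|(K)$ is the total variation on a compact set $K\subset Q$, and $C_c(Q)$ is the space of real-valued continuous functions with compact support in $Q$. Let $$\mathcal K=\Big\{\rho\in C_c^\infty(B_1):\ \int\rho=1,\ \rho\ge0,\ \rho\text{ even}\Big\},\qquad \delta_\xi u(x,t)=u(x+\xi,t)-u(x,t),$$ and,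 for $\rho\in\mathcal K$ and $\varepsilon>0$, $$D^\rho_\varepsilon[u](x,t)=\frac1{4\varepsilon}\int_{B_1}\nabla\rho(z)\cdot\delta_{\varepsilon z}u(x,t)\,|\delta_{\varepsilon z}u(x,t)|^2\,dz ,$$ which is defined locally in $Q$ for small $\varepsilon$. Convergence $D^\rho_{\varepsilon_n}[u]\rightharpoonup D$ as $\varepsilon_n\to0^+$, with $D\in\mathcal M_{\rm loc}(Q)$, means that $\int\varphi\, D^\rho_{\varepsilon_n}[u]\,dx\,dt\to\langle D,\varphi\rangle$ for all $\varphi\in C_c(Q)$. **Theorem (Onsager's critical measure).** Assume that one of the following holds for all $I\subset\subset(0,T)$ and $O\subset\subset\Omega$: - (A$_p$) $u\in L^p(I;B^{1/p}_{p,\infty}(O))\cap L^{2p'}(I;B^{1/(2p')}_{2p',\infty}(O))$, for some $p\in(1,\infty)$ independent of $I,O$; - (B) $u\in L^2(I;B^{1/2}_{2,\infty}(O))\cap L^\infty(I\times O)$; - (C) $u\in L^1(I;BV(O))\cap L^\infty(I\times O)$. Let $\varepsilon_n\to0^+$ be any sequence. Then there is a map $z\mapsto\mu_z$ from $\overline B_1$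 to $\mathcal M_{\rm loc}(Q;\mathbb R^d)$, continuous with respect to $\|\cdot\|_{\mathcal M(K)}$ for every compact $K\subset Q$ and independent of the kernel, such that: 1. for every $\rho\in\mathcal K$ and every $D\in\mathcal M_{\rm loc}(Q)$ with $D^\rho_{\varepsilon_n}[u]\rightharpoonup D$, $$\langle D,\varphi\rangle=\frac14\int_{B_1}\nabla\rho(z)\cdot\langle\mu_z,\varphi\rangle\,dz\qquad\forall\varphi\in C_c(Q);$$ moreover there is a subsequence $(\varepsilon_{n_k})$, the same for all kernels, such that for every $\rho\in\mathcal K$ the measures $D^\rho_{\varepsilon_{n_k}}[u]$ converge weakly to a $D\in\mathcal M_{\rm loc}(Q)$ given by this formula; 2. if $D\in\mathcal M_{\rm loc}(Q)$ does not depend on the kernel, that is $D^\rho_{\varepsilon_n}[u]\rightharpoonup D$ for every $\rho\in\mathcal K$, then $$|\langle D,\varphi\rangle|=\frac14\inf_{\rho\in\mathcal K}\Big|\int_{B_1}\nabla\rho(z)\cdot\langle\mu_z,\varphi\rangle\,dz\Big|\qquad\forall\varphi\in C_c(Q);$$ 3. (Hölder continuity) for every compact $K\subset Q$ there is a constant $C>0$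 depending only on $u$ and $K$ (and on $p$ in case (A$_p$)), not on the sequence $\varepsilon_n$, such that for all $z_1,z_2\in\overline B_1$ $$\text{(A}_p)\Rightarrow\ \|\mu_{z_1}-\mu_{z_2}\|_{\mathcal M(K)}\le C|z_1-z_2|^{\alpha_p}\big(|z_1|^{\beta_p}+|z_2|^{\beta_p}\big),$$ $$\text{(B)}\Rightarrow\ \|\mu_{z_1}-\mu_{z_2}\|_{\mathcal M(K)}\le C|z_1-z_2|^{1/2}\big(|z_1|^{1/2}+|z_2|^{1/2}\big),$$ $$\text{(C)}\Rightarrow\ \|\mu_{z_1}-\mu_{z_2}\|_{\mathcal M(K)}\le C|z_1-z_2|,$$ where $\alpha_p=\max\big(\tfrac1p,\tfrac1{2p'}\big)$ and $\beta_p=\min\big(\tfrac1{p'},\tfrac{p+1}{2p}\big)$; 4. (vanishing at the origin) $\mu_0=0$; 5. (oddness) for all $\rho\in\mathcal K$ and $\varphi\in C_c(Q)$, $$\int_{B_1}\nabla\rho(z)\cdot\langle\mu_{-z},\varphi\rangle\,dz=-\int_{B_1}\nabla\rho(z)\cdot\langle\mu_z,\varphi\rangle\,dz .$$ -/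

import Mathlib

open MeasureTheory Set Filter Topology Metric
open scoped ENNReal ContDiff

noncomputable section

/-- The Euclidean space `ℝ^d`. -/
abbrev Eucl (d : ℕ) : Type := EuclideanSpace ℝ (Fin d)

/-! ### Radon measures on an open set -/

/-- `F`-valued Radon measures on `U`: vector-valued Borel measures which are defined on the Borel
sets contained in compact subsets of `U` and have finite total variation on each compact subset.
Such a measure `μ` is given by its restrictions `on K = μ ⌞ K` to the compact sets `K ⊆ U`, which
are genuine (countably additive, finite variation) vector measures compatible with each other;
`on K` is normalised to be `0` when `K` is not a compact subset of `U`. -/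
@[ext]
structure RadonVectorMeasure {X : Type*} [TopologicalSpace X] [MeasurableSpace X]
    (U : Set X) (F : Type*) [NormedAddCommGroup F] where
  on : Set X → VectorMeasure X F
  on_restrict : ∀ K L : Set X, IsCompact K → IsCompact L → K ⊆ L → L ⊆ U →
    (on L).restrict K = on K
  finite : ∀ K : Set X, IsCompact K → K ⊆ U → (on K).variation univ < ⊤
  on_eq_zero : ∀ K : Set X, ¬ (IsCompact K ∧ K ⊆ U) → on K = 0

namespace RadonVectorMeasure

variable {X : Type*} [TopologicalSpace X] [MeasurableSpace X] {U : Set X}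
  {F : Type*} [NormedAddCommGroup F]

instance : Zero (RadonVectorMeasure U F) where
  zero :=
    { on := fun _ => 0
      on_restrict := by intros; simp
      finite := by intros; simp
      on_eq_zero := by intros; rfl }

instance : Sub (RadonVectorMeasure U F) where
  sub μ ν :=
    { on := fun K => μ.on K - ν.on K
      on_restrict := by
        intro K L hK hL hKL hLU
        rw [← μ.on_restrict K L hK hL hKL hLU, ← ν.on_restrict K L hK hL hKL hLU]
        by_cases hm : MeasurableSet K
        · ext A hA
          simp [VectorMeasure.restrict_apply _ hm hA]
        · simp [VectorMeasure.restrict_not_measurable _ hm]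
      finite := by
        intro K hK hKU
        refine lt_of_le_of_lt (VectorMeasure.variation_sub_le univ) ?_
        exact ENNReal.add_lt_top.2 ⟨μ.finite K hK hKU, ν.finite K hK hKU⟩
      on_eq_zero := by
        intro K hK
        rw [μ.on_eq_zero K hK, ν.on_eq_zero K hK, sub_zero] }

/-- The total variation `‖μ‖_{M(K)} = |μ|(K)` on a compact set `K ⊆ U`. -/
def mass (μ : RadonVectorMeasure U F) (K : Set X) : ℝ≥0∞ := (μ.on K).variation K

/-- The pairing `⟨μ, φ⟩ = ∫ φ dμ ∈ F` with a scalar function `φ` with compact support in `U`. -/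
def pairing [NormedSpace ℝ F] (μ : RadonVectorMeasure U F) (φ : X → ℝ) : F :=
  (μ.on (tsupport φ)).integral φ (ContinuousLinearMap.lsmul ℝ ℝ)

end RadonVectorMeasure

/-- `φ ∈ C_c(U)`. -/
def IsTestFunction {X : Type*} [TopologicalSpace X] (U : Set X) (φ : X → ℝ) : Prop :=
  Continuous φ ∧ HasCompactSupport φ ∧ tsupport φ ⊆ U

/-- The functions `f n`, seen as measures on `U`, converge weakly to the Radon measure `D`. -/
def WeaklyConverges {X : Type*} [TopologicalSpace X] [MeasureSpace X] {U : Set X}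
    (f : ℕ → X → ℝ) (D : RadonVectorMeasure U ℝ) : Prop :=
  ∀ φ : X → ℝ, IsTestFunction U φ →
    Tendsto (fun n => ∫ y, φ y * f n y) atTop (𝓝 (D.pairing φ))

/-! ### Besov and BV norms -/

/-- `O` is open and compactly contained in `Ω`. -/
def CompactlyContained {X : Type*} [TopologicalSpace X] (O Ω : Set X) : Prop :=
  IsOpen O ∧ IsCompact (closure O) ∧ closure O ⊆ Ω

/-- The full norm `‖f‖_{L^q(O)} + [f]_{B^θ_{q,∞}(O)}` (possibly `∞`), where the seminorm is the
supremum over `h ≠ 0` of `|h|^{-θ} ‖f(· + h) - f‖_{L^q}`, the `L^q` norm being over those `x ∈ O`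
for which also `x + h ∈ O`. -/
def besovNorm {d : ℕ} (θ q : ℝ) (O : Set (Eucl d)) (f : Eucl d → Eucl d) : ℝ≥0∞ :=
  eLpNorm f (ENNReal.ofReal q) (volume.restrict O) +
    ⨆ (h : Eucl d) (_ : h ≠ 0),
      eLpNorm (fun x => f (x + h) - f x) (ENNReal.ofReal q)
        (volume.restrict {x | x ∈ O ∧ x + h ∈ O}) / ‖h‖ₑ ^ θ

/-- The divergence of a vector field. -/
def divergence {d : ℕ} (Φ : Eucl d → Eucl d) (x : Eucl d) : ℝ :=
  ∑ j, (fderiv ℝ Φ x (EuclideanSpace.single j 1)) j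

/-- The total variation `|∇f|(O)` of the distributional gradient of a vector field: the supremum of
`∑ i, ∫_O f_i div Φ_i` over matrix fields `Φ ∈ C_c^∞(O)`, with rows `Φ_i`, which are bounded by `1`
in the Euclidean (Frobenius) norm. -/
def gradientVariation {d : ℕ} (O : Set (Eucl d)) (f : Eucl d → Eucl d) : ℝ≥0∞ :=
  ⨆ (Φ : Fin d → Eucl d → Eucl d)
    (_ : ∀ i, ContDiff ℝ ∞ (Φ i) ∧ HasCompactSupport (Φ i) ∧ tsupport (Φ i) ⊆ O)
    (_ : ∀ x, ∑ i, ‖Φ i x‖ ^ 2 ≤ 1),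
      ENNReal.ofReal (∫ x in O, ∑ i, f x i * divergence (Φ i) x)

/-- The `BV(O)` norm `‖f‖_{L^1(O)} + |∇f|(O)` (possibly `∞`). -/
def bvNorm {d : ℕ} (O : Set (Eucl d)) (f : Eucl d → Eucl d) : ℝ≥0∞ :=
  eLpNorm f 1 (volume.restrict O) + gradientVariation O f

/-- `u ∈ L^q(I; B^θ_{q,∞}(O))` for all open `I ⊂⊂ (0,T)` and `O ⊂⊂ Ω`. -/
def LocLpBesov {d : ℕ} (Ω : Set (Eucl d)) (T θ q : ℝ) (u : Eucl d × ℝ → Eucl d) : Prop :=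
  ∀ (I : Set ℝ) (O : Set (Eucl d)), CompactlyContained I (Ioo 0 T) → CompactlyContained O Ω →
    ∫⁻ t in I, besovNorm θ q O (fun x => u (x, t)) ^ q < ⊤

/-- `u ∈ L^1(I; BV(O))` for all open `I ⊂⊂ (0,T)` and `O ⊂⊂ Ω`. -/
def LocL1BV {d : ℕ} (Ω : Set (Eucl d)) (T : ℝ) (u : Eucl d × ℝ → Eucl d) : Prop :=
  ∀ (I : Set ℝ) (O : Set (Eucl d)), CompactlyContained I (Ioo 0 T) → CompactlyContained O Ω →
    ∫⁻ t in I, bvNorm O (fun x => u (x, t)) < ⊤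

/-- `u ∈ L^∞(I × O)` for all open `I ⊂⊂ (0,T)` and `O ⊂⊂ Ω`. -/
def LocLinfty {d : ℕ} (Ω : Set (Eucl d)) (T : ℝ) (u : Eucl d × ℝ → Eucl d) : Prop :=
  ∀ (I : Set ℝ) (O : Set (Eucl d)), CompactlyContained I (Ioo 0 T) → CompactlyContained O Ω →
    eLpNorm u ⊤ (volume.restrict (O ×ˢ I)) < ⊤

/-- The conjugate exponent `p' = p / (p - 1)` of `p ∈ (1, ∞)`. -/
def conjExp (p : ℝ) : ℝ := p / (p - 1)

/-- First critical class:
`L^p_t B^{1/p}_{p,∞} ∩ L^{2p'}_t B^{1/(2p')}_{2p',∞}`, locally in space-time. -/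
def BesovClass {d : ℕ} (Ω : Set (Eucl d)) (T p : ℝ) (u : Eucl d × ℝ → Eucl d) : Prop :=
  LocLpBesov Ω T (1 / p) p u ∧ LocLpBesov Ω T (1 / (2 * conjExp p)) (2 * conjExp p) u

/-- Second critical class: `L^2_t B^{1/2}_{2,∞} ∩ L^∞`, locally in space-time. -/
def HalfClass {d : ℕ} (Ω : Set (Eucl d)) (T : ℝ) (u : Eucl d × ℝ → Eucl d) : Prop :=
  LocLpBesov Ω T (1 / 2) 2 u ∧ LocLinfty Ω T u

/-- Third critical class: `L^1_t BV ∩ L^∞`, locally in space-time. -/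
def BVClass {d : ℕ} (Ω : Set (Eucl d)) (T : ℝ) (u : Eucl d × ℝ → Eucl d) : Prop :=
  LocL1BV Ω T u ∧ LocLinfty Ω T u

/-! ### The Duchon--Robert approximations -/

/-- The class of kernels: smooth, compactly supported in the open unit ball, of integral one,
nonnegative and even. -/
def IsKernel {d : ℕ} (ρ : Eucl d → ℝ) : Prop :=
  ContDiff ℝ ∞ ρ ∧ tsupport ρ ⊆ ball 0 1 ∧ ∫ z, ρ z = 1 ∧ (∀ z, 0 ≤ ρ z) ∧ ∀ z, ρ (-z) = ρ z

/-- The spatial increment `δ_ξ u (x,t) = u(x + ξ, t) - u(x,t)`. -/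
def increment {d : ℕ} (u : Eucl d × ℝ → Eucl d) (ξ : Eucl d) (y : Eucl d × ℝ) : Eucl d :=
  u (y.1 + ξ, y.2) - u y

/-- `D_ε[u] = (4ε)⁻¹ ∫ ∇ρ(z) · δ_{εz}u |δ_{εz}u|² dz`. -/
def duchonRobert {d : ℕ} (ρ : Eucl d → ℝ) (u : Eucl d × ℝ → Eucl d) (ε : ℝ)
    (y : Eucl d × ℝ) : ℝ :=
  1 / (4 * ε) * ∫ z, inner ℝ (gradient ρ z) (increment u (ε • z) y) *
    ‖increment u (ε • z) y‖ ^ 2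

/-- `∫_{B_1} ∇ρ(z) · ⟨μ_z, φ⟩ dz`. -/
def kernelIntegral {d : ℕ} {U : Set (Eucl d × ℝ)} (ρ : Eucl d → ℝ)
    (μ : Eucl d → RadonVectorMeasure U (Eucl d)) (φ : Eucl d × ℝ → ℝ) : ℝ :=
  ∫ z in ball (0 : Eucl d) 1, inner ℝ (gradient ρ z) ((μ z).pairing φ)

end

noncomputable section

open scoped CompactlySupported

/-! ### Weak limits of locally `L¹`-bounded nonnegative functions -/

section WeakLimits

/-! Put `w_ε(z) = ε⁻¹ |δ_{εz}u|² δ_{εz}u` (`cubicIncrement`). Then `D_ε = ¼ ∫ ∇ρ(z) · w_ε(z) dz`, so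
the kernel enters only through a linear functional of `z ↦ w_ε(z)`. It suffices to find weak limits
`μ_z` of `w_ε(z)`, for all `z` at once, with good control in `z`.

The core is `CubicHolder.of_incrementBound`, an `L¹` Hölder estimate for `z ↦ w_ε(z)`, uniform in
small `ε`. In each class the increments `u(· + a) - u(· + b)` are locally `O(|a - b|^θᵢ)` in
`L^{qᵢ}` for three pairs with `∑ 1/qᵢ = 1` and `∑ θᵢ = 1`. Hölder's inequality applied to the cubic
expression then produces exactly one power of `ε`, which cancels `ε⁻¹`: this is criticality. For
Besov classes the increment bounds are the definition plus integration in time; for `BV` they follow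
by duality (`eLpNorm_translate_sub_le_gradientVariation`).

So the maps `z ↦ w_ε(z)` are locally bounded and equicontinuous with values in `L¹`. Extraction over
dense sets of `z` and of test functions (`exists_subseq_integral_smul_tendsto`) gives one
subsequence along which all pairings converge. To realise the limits as measures, one passes to an
ultrafilter: the positive and negative parts of the coordinates have limits by the
Riesz–Markov–Kakutani theorem, and are recombined. A limit `κ` of `|w_ε(z₁) - w_ε(z₂)|` dominates
the differences of these parts (`FrameLimit.mass_sub_le`), so the Hölder estimate passes to the
total variation.

Fubini and dominated convergence in `z` give the formula along the subsequence, and a weak limit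
along the full sequence must agree with it. If `D` is the limit for every kernel, the infimum is
over a constant nonempty family. Oddness holds because `∇ρ` is odd. As `u` is only a.e. measurable,
all this is done for a Borel representative. -/

theorem Ultrafilter.exists_tendsto_of_norm_le {ι E : Type*} [NormedAddCommGroup E] [ProperSpace E]
    (l : Ultrafilter ι) {a : ι → E} {R : ℝ} (h : ∀ᶠ n in l, ‖a n‖ ≤ R) :
    ∃ x, Tendsto a l (𝓝 x) := by
  obtain ⟨x, -, hx⟩ := (isCompact_closedBall (0 : E) R).ultrafilter_le_nhds (l.map a)
    (by rw [le_principal_iff, Ultrafilter.coe_map, Filter.mem_map]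
        filter_upwards [h] with n hn
        simpa using hn)
  exact ⟨x, hx⟩

section Bounds

variable {X : Type*} [MeasurableSpace X] {F : Type*} [NormedAddCommGroup F] [NormedSpace ℝ F]

theorem integrable_smul_of_support_subset {m : Measure X} {K : Set X} {φ : X → ℝ} {f : X → F}
    {B : ℝ} (hφ : AEStronglyMeasurable φ m)
    (hf : AEStronglyMeasurable f m) (hB : ∀ x, ‖φ x‖ ≤ B) (hK : Function.support φ ⊆ K)
    (hfin : ∫⁻ x in K, ‖f x‖ₑ ∂m < ⊤) :
    Integrable (fun x => φ x • f x) m := by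
  have h1 : IntegrableOn f K m := ⟨hf.restrict, hfin⟩
  have h2 : IntegrableOn (fun x => φ x • f x) K m := by
    exact h1.bdd_smul B hφ.restrict (Eventually.of_forall hB)
  refine (integrableOn_iff_integrable_of_support_subset ?_).1 h2
  intro x hx
  apply hK
  intro h
  apply hx
  simp [h]

theorem norm_integral_smul_le_of_support_subset {m : Measure X} {K : Set X} {φ : X → ℝ}
    {f : X → F} {B : ℝ} {c : ℝ≥0∞} (hf : AEStronglyMeasurable f m)
    (hc : c ≠ ⊤) (hB0 : 0 ≤ B) (hB : ∀ x, ‖φ x‖ ≤ B) (hK : Function.support φ ⊆ K)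
    (hfin : ∫⁻ x in K, ‖f x‖ₑ ∂m ≤ c) :
    ‖∫ x, φ x • f x ∂m‖ ≤ B * c.toReal := by
  have h1 : IntegrableOn f K m := ⟨hf.restrict, hfin.trans_lt hc.lt_top⟩
  have : ∫ x, φ x • f x ∂m = ∫ x in K, φ x • f x ∂m := by
    rw [setIntegral_eq_integral_of_forall_compl_eq_zero]
    intro x hx
    have : φ x = 0 := by by_contra h; exact hx (hK h)
    simp [this]
  rw [this]
  calc ‖∫ x in K, φ x • f x ∂m‖ ≤ ∫ x in K, B * ‖f x‖ ∂m := by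
        refine norm_integral_le_of_norm_le (h1.norm.const_mul B) (Eventually.of_forall fun x => ?_)
        rw [norm_smul]
        exact mul_le_mul_of_nonneg_right (hB x) (norm_nonneg _)
    _ = B * ∫ x in K, ‖f x‖ ∂m := integral_const_mul _ _
    _ ≤ B * c.toReal := by
        gcongr
        rw [integral_norm_eq_lintegral_enorm hf.restrict]
        exact ENNReal.toReal_mono hc hfin

end Bounds

variable {X : Type*} [TopologicalSpace X]

theorem IsTestFunction.exists_bound {U : Set X} {φ : X → ℝ} (hφ : IsTestFunction U φ) :
    ∃ C, 0 ≤ C ∧ ∀ x, ‖φ x‖ ≤ C := by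
  obtain ⟨C, hC⟩ := hφ.2.1.exists_bound_of_continuous hφ.1
  exact ⟨max C 0, le_max_right _ _, fun x => (hC x).trans (le_max_left _ _)⟩

theorem exists_testFunction [T2Space X] [LocallyCompactSpace X] {U K V : Set X}
    (hK : IsCompact K) (hV : IsOpen V)
    (hKV : K ⊆ V) (hVU : V ⊆ U) :
    ∃ φ, IsTestFunction U φ ∧ (∀ x ∈ K, φ x = 1) ∧ (∀ x, 0 ≤ φ x) ∧ (∀ x, φ x ≤ 1) ∧
      tsupport φ ⊆ V := by
  obtain ⟨L, hL, hKL, hLV⟩ := exists_compact_between hK hV hKV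
  obtain ⟨φ, h1, h0, hc, h01⟩ := exists_continuous_one_zero_of_isCompact hK
    isOpen_interior.isClosed_compl (disjoint_compl_right_iff_subset.2 hKL)
  have hs : tsupport φ ⊆ V := by
    refine (closure_minimal ?_ hL.isClosed).trans hLV
    intro x hx
    by_contra hxL
    exact hx (h0 fun h => hxL (interior_subset h))
  exact ⟨φ, ⟨φ.continuous, hc, hs.trans hVU⟩, h1, fun x => (h01 x).1, fun x => (h01 x).2, hs⟩

variable [MeasurableSpace X]

/-- Along `l`, the functions `f n` are bounded in `L¹(m)` on every compact subset of `U`. -/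
def LocBddL1 {ι F : Type*} [NormedAddCommGroup F] (U : Set X) (m : Measure X) (l : Filter ι)
    (f : ι → X → F) : Prop :=
  ∀ K, IsCompact K → K ⊆ U → ∃ C : ℝ≥0∞, C ≠ ⊤ ∧ ∀ᶠ n in l, ∫⁻ x in K, ‖f n x‖ₑ ∂m ≤ C

/-- Along `l`, the functions `f n`, seen as densities with respect to `m`, converge weakly in `U`
to the positive measure `ν`, which is finite on compact subsets of `U`. -/
structure WeakLimit {ι : Type*} (U : Set X) (m : Measure X) (l : Filter ι) (f : ι → X → ℝ)
    (ν : Measure X) : Prop where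
  lt_top : ∀ K, IsCompact K → K ⊆ U → ν K < ⊤
  tendsto : ∀ φ, IsTestFunction U φ → Tendsto (fun n => ∫ x, φ x * f n x ∂m) l (𝓝 (∫ x, φ x ∂ν))

theorem LocBddL1.mono {κ F F' : Type*} [NormedAddCommGroup F] [NormedAddCommGroup F'] {U : Set X}
    {m : Measure X} {l : Filter κ} {f : κ → X → F} {f' : κ → X → F'}
    (h : LocBddL1 U m l f) (hle : ∀ n x, ‖f' n x‖ₑ ≤ ‖f n x‖ₑ) : LocBddL1 U m l f' := by
  intro K hK hKU
  obtain ⟨C, hC, hn⟩ := h K hK hKU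
  exact ⟨C, hC, hn.mono fun n hn => (lintegral_mono fun x => hle n x).trans hn⟩

variable [BorelSpace X]

theorem IsTestFunction.integrable {U : Set X} {φ : X → ℝ} (hφ : IsTestFunction U φ)
    {ν : Measure X} (hν : ∀ K, IsCompact K → K ⊆ U → ν K < ⊤) : Integrable φ ν := by
  obtain ⟨C, -, hC⟩ := hφ.exists_bound
  have h := hν _ hφ.2.1 hφ.2.2
  refine (integrableOn_iff_integrable_of_support_subset (subset_tsupport φ)).1 ?_
  exact IntegrableOn.of_bound h hφ.1.aestronglyMeasurable.restrict C (Eventually.of_forall hC)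

theorem LocBddL1.eventually_integrable_smul {ι F : Type*} [NormedAddCommGroup F] [NormedSpace ℝ F]
    {U : Set X} {m : Measure X} {l : Filter ι} {f : ι → X → F} (h : LocBddL1 U m l f)
    (hf : ∀ n, AEStronglyMeasurable (f n) m) {φ : X → ℝ} (hφ : IsTestFunction U φ) :
    ∀ᶠ n in l, Integrable (fun x => φ x • f n x) m := by
  obtain ⟨C, hC, hn⟩ := h _ hφ.2.1 hφ.2.2
  obtain ⟨B, -, hB⟩ := hφ.exists_bound
  filter_upwards [hn] with n hn
  exact integrable_smul_of_support_subset hφ.1.aestronglyMeasurable (hf n) hB (subset_tsupport φ)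
    (hn.trans_lt hC.lt_top)

/-- Along an ultrafilter bounded pairings converge without extraction, and their limit is a positive
functional on `C_c(U)`. Riesz–Markov–Kakutani applies on the locally compact space `U`, and the
measure is pushed forward to `X`. -/
theorem LocBddL1.exists_weakLimit [T2Space X] [LocallyCompactSpace X]
    {ι : Type*} {U : Set X} (hU : IsOpen U) {m : Measure X} (l : Ultrafilter ι) {f : ι → X → ℝ}
    (hb : LocBddL1 U m l f) (hf : ∀ n, AEStronglyMeasurable (f n) m) (h0 : ∀ n x, 0 ≤ f n x) :
    ∃ ν, WeakLimit U m l f ν := by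
  have key : ∀ φ : C_c(U, ℝ), IsTestFunction U (Function.extend Subtype.val φ 0) := fun φ =>
    ⟨φ.hasCompactSupport.continuous_extend_zero hU φ.continuous,
      φ.hasCompactSupport.extend_zero continuous_subtype_val,
      (φ.hasCompactSupport.tsupport_extend_zero_subset continuous_subtype_val).trans
        (Subtype.coe_image_subset _ _)⟩
  set E : C_c(U, ℝ) → X → ℝ := fun φ => Function.extend Subtype.val φ 0 with hE
  have hEval : ∀ φ (x : U), E φ x = φ x := fun φ x => Subtype.val_injective.extend_apply _ _ _
  have hEout : ∀ φ x, x ∉ U → E φ x = 0 := fun φ x hx => by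
    rw [hE]; simp only
    rw [Function.extend_apply']
    · rfl
    · rintro ⟨a, rfl⟩; exact hx a.2
  have hadd : ∀ φ ψ x, E (φ + ψ) x = E φ x + E ψ x := fun φ ψ x => by
    by_cases hx : x ∈ U
    · simp only [hEval _ ⟨x, hx⟩, CompactlySupportedContinuousMap.coe_add, Pi.add_apply]
    · simp [hEout _ x hx]
  have hsmul : ∀ (c : ℝ) φ x, E (c • φ) x = c * E φ x := fun c φ x => by
    by_cases hx : x ∈ U
    · simp only [hEval _ ⟨x, hx⟩, CompactlySupportedContinuousMap.coe_smul, Pi.smul_apply,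
        smul_eq_mul]
    · simp [hEout _ x hx]
  have hint : ∀ φ, ∀ᶠ n in l, Integrable (fun x => E φ x * f n x) m := fun φ =>
    hb.eventually_integrable_smul hf (key φ)
  have hex : ∀ φ, ∃ r, Tendsto (fun n => ∫ x, E φ x * f n x ∂m) l (𝓝 r) := fun φ => by
    obtain ⟨C, hC, hn⟩ := hb _ (key φ).2.1 (key φ).2.2
    obtain ⟨B, hB0, hB⟩ := (key φ).exists_bound
    refine l.exists_tendsto_of_norm_le (R := B * C.toReal) ?_
    filter_upwards [hn] with n hn
    exact norm_integral_smul_le_of_support_subset (hf n) hC hB0 hB (subset_tsupport _) hn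
  choose Λ hΛ using hex
  let Λ₁ : C_c(U, ℝ) →ₗ[ℝ] ℝ :=
    { toFun := Λ
      map_add' := fun φ ψ => by
        refine tendsto_nhds_unique (hΛ (φ + ψ)) (((hΛ φ).add (hΛ ψ)).congr' ?_)
        filter_upwards [hint φ, hint ψ] with n h1 h2
        rw [← integral_add h1 h2]
        simp only [hadd, add_mul]
      map_smul' := fun c φ => by
        refine tendsto_nhds_unique (hΛ (c • φ)) (((hΛ φ).const_mul c).congr fun n => ?_)
        rw [← integral_const_mul]
        simp only [hsmul, mul_assoc] }
  have hpos : ∀ φ : C_c(U, ℝ), 0 ≤ φ → 0 ≤ Λ₁ φ := fun φ hφ => by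
    refine ge_of_tendsto' (hΛ φ) fun n => integral_nonneg fun x => mul_nonneg ?_ (h0 n x)
    by_cases hx : x ∈ U
    · have := hφ ⟨x, hx⟩
      simpa [hEval φ ⟨x, hx⟩] using this
    · simp [hEout _ x hx]
  have : LocallyCompactSpace U := hU.locallyCompactSpace
  let Λ₂ : C_c(U, ℝ) →ₚ[ℝ] ℝ := PositiveLinearMap.mk₀ Λ₁ hpos
  refine ⟨(RealRMK.rieszMeasure Λ₂).map Subtype.val, ?_, ?_⟩
  · intro K hK hKU
    rw [Measure.map_apply measurable_subtype_coe hK.measurableSet]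
    refine IsCompact.measure_lt_top ?_
    exact Topology.IsInducing.subtypeVal.isCompact_preimage' hK (by simpa using hKU)
  · intro φ hφ
    let φ' : C_c(U, ℝ) :=
      { toFun := fun x => φ x
        continuous_toFun := hφ.1.comp continuous_subtype_val
        hasCompactSupport' := by
          refine HasCompactSupport.of_support_subset_isCompact
            (Topology.IsInducing.subtypeVal.isCompact_preimage' hφ.2.1
              (by simpa using hφ.2.2)) ?_
          intro x hx
          exact subset_tsupport φ hx }
    have h1 : E φ' = φ := by
      funext x
      by_cases hx : x ∈ U
      · exact hEval φ' ⟨x, hx⟩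
      · rw [hEout _ x hx]
        exact (image_eq_zero_of_notMem_tsupport fun h => hx (hφ.2.2 h)).symm
    have h2 : ∫ x, φ x ∂(RealRMK.rieszMeasure Λ₂).map Subtype.val = Λ φ' := by
      rw [(MeasurableEmbedding.subtype_coe hU.measurableSet).integral_map]
      exact RealRMK.integral_rieszMeasure Λ₂ φ'
    rw [h2, ← h1]
    exact hΛ φ'

/-- Test with a function equal to `1` on `K` and supported in `L`. The bound is needed on a
neighbourhood `L` because mass may move onto `K` from outside in the limit. -/
theorem WeakLimit.measure_le [T2Space X] [LocallyCompactSpace X] 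
    {ι : Type*} {U : Set X} {m : Measure X} {l : Filter ι} [l.NeBot] {f : ι → X → ℝ}
    {ν : Measure X} (h : WeakLimit U m l f ν) (hf : ∀ n, AEStronglyMeasurable (f n) m)
    {K L : Set X} (hK : IsCompact K) (hLU : L ⊆ U) (hKL : K ⊆ interior L)
    {c : ℝ≥0∞} (hc : ∀ᶠ n in l, ∫⁻ x in L, ‖f n x‖ₑ ∂m ≤ c) : ν K ≤ c := by
  rcases eq_or_ne c ⊤ with rfl | hct
  · exact le_top
  obtain ⟨φ, hφ, h1, hp, hp1, hs⟩ :=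
    exists_testFunction hK isOpen_interior hKL (interior_subset.trans hLU)
  have h2 : ∫ x, φ x ∂ν ≤ c.toReal := by
    refine le_of_tendsto (h.tendsto φ hφ) ?_
    filter_upwards [hc] with n hn
    refine (le_abs_self _).trans ?_
    have := norm_integral_smul_le_of_support_subset (hf n) hct zero_le_one
      (φ := φ) (fun x => by rw [Real.norm_of_nonneg (hp x)]; exact hp1 x)
      ((subset_tsupport φ).trans (hs.trans interior_subset)) hn
    simpa using this
  have hi := hφ.integrable h.lt_top
  calc ν K = ∫⁻ x in K, 1 ∂ν := by simp
    _ ≤ ∫⁻ x in K, ENNReal.ofReal (φ x) ∂ν := by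
        refine setLIntegral_mono' hK.measurableSet fun x hx => by simp [h1 x hx]
    _ ≤ ∫⁻ x, ENNReal.ofReal (φ x) ∂ν := setLIntegral_le_lintegral _ _
    _ = ENNReal.ofReal (∫ x, φ x ∂ν) :=
        (ofReal_integral_eq_lintegral_ofReal hi (Eventually.of_forall hp)).symm
    _ ≤ ENNReal.ofReal c.toReal := ENNReal.ofReal_le_ofReal h2
    _ = c := ENNReal.ofReal_toReal hct

end WeakLimits

/-! ### Inequalities between densities pass to the limit measures -/

section Domination

variable {X : Type*} [MetricSpace X] [MeasurableSpace X] [BorelSpace X] [LocallyCompactSpace X]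

/-- The pointwise inequality is tested with a cutoff of `K` supported in a neighbourhood of `K` on
which `ν₂ + κ` exceeds its value on `K` by at most `ε`. Restricting to the compact set `L` makes the
measure finite, hence outer regular. -/
theorem WeakLimit.measure_le_add_of_isCompact {ι : Type*} {U : Set X} (hU : IsOpen U)
    {m : Measure X} {l : Filter ι}
    [l.NeBot] {f₁ f₂ g : ι → X → ℝ} {ν₁ ν₂ κ : Measure X} (h₁ : WeakLimit U m l f₁ ν₁)
    (h₂ : WeakLimit U m l f₂ ν₂) (hg : WeakLimit U m l g κ)
    (m₁ : ∀ n, AEStronglyMeasurable (f₁ n) m) (m₂ : ∀ n, AEStronglyMeasurable (f₂ n) m)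
    (mg : ∀ n, AEStronglyMeasurable (g n) m) (b₁ : LocBddL1 U m l f₁) (b₂ : LocBddL1 U m l f₂)
    (bg : LocBddL1 U m l g) (hle : ∀ n x, f₁ n x ≤ f₂ n x + g n x) {K : Set X}
    (hK : IsCompact K) (hKU : K ⊆ U) : ν₁ K ≤ ν₂ K + κ K := by
  obtain ⟨L, hL, hKL, hLU⟩ := exists_compact_between hK hU hKU
  have hfin : (ν₂ + κ) L < ⊤ := by
    simpa using ⟨h₂.lt_top L hL hLU, hg.lt_top L hL hLU⟩
  have : IsFiniteMeasure ((ν₂ + κ).restrict L) := ⟨by simpa using hfin⟩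
  refine ENNReal.le_of_forall_pos_le_add fun ε hε _ => ?_
  obtain ⟨V, hKV, hV, hVε⟩ := K.exists_isOpen_le_add ((ν₂ + κ).restrict L)
    (ε := (ε : ℝ≥0∞)) (by simpa using hε.ne')
  obtain ⟨φ, hφ, h1, hp, hp1, hs⟩ := exists_testFunction hK (hV.inter isOpen_interior)
    (subset_inter hKV hKL) (inter_subset_right.trans (interior_subset.trans hLU))
  have i₁ := hφ.integrable h₁.lt_top
  have i₂ := hφ.integrable h₂.lt_top
  have i₃ := hφ.integrable hg.lt_top
  have hlim : ∫ x, φ x ∂ν₁ ≤ ∫ x, φ x ∂ν₂ + ∫ x, φ x ∂κ := by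
    refine le_of_tendsto_of_tendsto (h₁.tendsto φ hφ)
      ((h₂.tendsto φ hφ).add (hg.tendsto φ hφ)) ?_
    filter_upwards [b₁.eventually_integrable_smul m₁ hφ, b₂.eventually_integrable_smul m₂ hφ,
      bg.eventually_integrable_smul mg hφ] with n e₁ e₂ e₃
    simp only [smul_eq_mul] at e₁ e₂ e₃
    rw [← integral_add e₂ e₃]
    refine integral_mono e₁ (e₂.add e₃) fun x => ?_
    simpa [mul_add] using mul_le_mul_of_nonneg_left (hle n x) (hp x)
  calc ν₁ K = ∫⁻ x in K, 1 ∂ν₁ := by simp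
    _ ≤ ∫⁻ x in K, ENNReal.ofReal (φ x) ∂ν₁ :=
        setLIntegral_mono' hK.measurableSet fun x hx => by simp [h1 x hx]
    _ ≤ ∫⁻ x, ENNReal.ofReal (φ x) ∂ν₁ := setLIntegral_le_lintegral _ _
    _ = ENNReal.ofReal (∫ x, φ x ∂ν₁) :=
        (ofReal_integral_eq_lintegral_ofReal i₁ (Eventually.of_forall hp)).symm
    _ ≤ ENNReal.ofReal (∫ x, φ x ∂(ν₂ + κ)) := by
        rw [integral_add_measure i₂ i₃]; exact ENNReal.ofReal_le_ofReal hlim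
    _ = ∫⁻ x, ENNReal.ofReal (φ x) ∂(ν₂ + κ) :=
        ofReal_integral_eq_lintegral_ofReal (i₂.add_measure i₃) (Eventually.of_forall hp)
    _ ≤ ∫⁻ x, (V ∩ L).indicator 1 x ∂(ν₂ + κ) := by
        refine lintegral_mono fun x => ?_
        by_cases hx : x ∈ V ∩ L
        · simpa [hx] using hp1 x
        · have : φ x = 0 := image_eq_zero_of_notMem_tsupport fun h =>
            hx ⟨(hs h).1, interior_subset (hs h).2⟩
          simp [this]
    _ = (ν₂ + κ).restrict L V := by
        rw [lintegral_indicator_one (hV.measurableSet.inter hL.measurableSet),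
          Measure.restrict_apply hV.measurableSet]
    _ ≤ (ν₂ + κ).restrict L K + ε := hVε
    _ ≤ ν₂ K + κ K + ε := by
        gcongr
        exact (Measure.restrict_le_self K).trans (by simp)

/-- Inner regularity of `ν₁` on `K` extends the compact case to measurable sets, which is what a
bound on the total variation of a vector measure requires. -/
theorem WeakLimit.measure_le_add {ι : Type*} {U : Set X} (hU : IsOpen U)
    {m : Measure X} {l : Filter ι}
    [l.NeBot] {f₁ f₂ g : ι → X → ℝ} {ν₁ ν₂ κ : Measure X} (h₁ : WeakLimit U m l f₁ ν₁)
    (h₂ : WeakLimit U m l f₂ ν₂) (hg : WeakLimit U m l g κ)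
    (m₁ : ∀ n, AEStronglyMeasurable (f₁ n) m) (m₂ : ∀ n, AEStronglyMeasurable (f₂ n) m)
    (mg : ∀ n, AEStronglyMeasurable (g n) m) (b₁ : LocBddL1 U m l f₁) (b₂ : LocBddL1 U m l f₂)
    (bg : LocBddL1 U m l g) (hle : ∀ n x, f₁ n x ≤ f₂ n x + g n x) {K A : Set X}
    (hK : IsCompact K) (hKU : K ⊆ U) (hA : MeasurableSet A) (hAK : A ⊆ K) :
    ν₁ A ≤ ν₂ A + κ A := by
  have : IsFiniteMeasure (ν₁.restrict K) := ⟨by simpa using h₁.lt_top K hK hKU⟩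
  have hr : ν₁ A = ν₁.restrict K A := by
    rw [Measure.restrict_apply hA, inter_eq_left.2 hAK]
  have : CompactSpace K := isCompact_iff_compactSpace.1 hK
  rw [hr]
  refine le_of_forall_lt fun r hrA => ?_
  obtain ⟨F, hFA, hF, hrF⟩ := hA.exists_isClosed_lt_add (μ := ν₁.restrict K)
    (ε := ν₁.restrict K A - r) (measure_ne_top _ _) (tsub_pos_of_lt hrA).ne'
  have hFK : IsCompact F := hK.of_isClosed_subset hF (hFA.trans hAK)
  have hrF' : r < ν₁.restrict K F := by
    by_contra! hcon
    have h5 : ν₁.restrict K A < r + (ν₁.restrict K A - r) := hrF.trans_le (by gcongr)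
    rw [add_tsub_cancel_of_le hrA.le] at h5
    exact lt_irrefl _ h5
  calc r < ν₁.restrict K F := hrF'
    _ ≤ ν₁ F := Measure.restrict_le_self F
    _ ≤ ν₂ F + κ F := h₁.measure_le_add_of_isCompact hU h₂ hg m₁ m₂ mg b₁ b₂ bg hle hFK
        ((hFA.trans hAK).trans hKU)
    _ ≤ ν₂ A + κ A := by gcongr

end Domination

/-! ### Vector-valued limits, decomposed into positive measures -/

section VectorMeasures

/-- The integral of a scalar function against `b ν`, with `ν` a positive finite measure. -/
theorem integral_withDensityᵥ_const {X F : Type*} [MeasurableSpace X] [NormedAddCommGroup F]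
    [NormedSpace ℝ F] [CompleteSpace F] (ν : Measure X) [IsFiniteMeasure ν] (b : F) {f : X → ℝ}
    (hf : Integrable f ν) :
    (ν.withDensityᵥ fun _ => b).integral f (ContinuousLinearMap.lsmul ℝ ℝ) =
      (∫ x, f x ∂ν) • b := by
  have hvar : (ν.withDensityᵥ fun _ => b).variation = ‖b‖ₑ • ν := by
    rw [Measure.variation_withDensityᵥ (integrable_const b), withDensity_const]
  have hint : ∀ {g : X → ℝ}, Integrable g ν →
      VectorMeasure.Integrable (ν.withDensityᵥ fun _ => b) g := fun {g} hg => by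
    rw [VectorMeasure.Integrable, hvar]
    exact hg.smul_measure (by simp)
  have hfin : IsFiniteMeasure (ν.withDensityᵥ fun _ => b).variation := by
    rw [hvar]; exact ν.smul_finite (by simp)
  refine Integrable.induction (P := fun f => (ν.withDensityᵥ fun _ => b).integral f
    (ContinuousLinearMap.lsmul ℝ ℝ) = (∫ x, f x ∂ν) • b) ?_ ?_ ?_ ?_ hf
  · intro c s hs _
    rw [VectorMeasure.integral_indicator hs, VectorMeasure.integral_const, integral_indicator hs]
    simp [withDensityᵥ_apply (integrable_const b) hs, smul_smul, mul_comm]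
  · intro f g _ hf hg h1 h2
    rw [VectorMeasure.integral_add (hint hf) (hint hg), h1, h2, integral_add' hf hg, add_smul]
  -- The vector integral is a `setToFun` relative to the variation `‖b‖ₑ • ν`. Rescaling the
  -- domination to `ν` itself gives continuity on `L¹(ν)`.
  · refine isClosed_eq ?_ (continuous_integral.smul continuous_const)
    have hT := dominatedFinMeasAdditive_cbmApplyMeasure (ν.withDensityᵥ fun _ => b)
      (ContinuousLinearMap.lsmul ℝ ℝ)
    rw [hvar] at hT
    have hT' := DominatedFinMeasAdditive.of_smul_measure (c := ‖b‖ₑ) (by simp) hT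
    refine (continuous_setToFun hT').congr fun f => ?_
    rw [setToFun_congr_smul_measure ‖b‖ₑ (by simp) hT' hT, VectorMeasure.integral_eq_setToFun]
    simp only [hvar]
  · intro f g hfg hf h
    rw [← integral_congr_ae hfg, ← h]
    refine (VectorMeasure.integral_congr_ae ?_).symm
    rw [hvar]
    exact Measure.ae_smul_measure hfg _

/-- A finite family of vectors `b j` with nonnegative, `1`-Lipschitz coordinate functions `c j`. -/
structure PositiveFrame (ι F : Type*) [Fintype ι] [NormedAddCommGroup F] [NormedSpace ℝ F] where
  b : ι → F
  c : ι → F → ℝ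
  nonneg : ∀ j v, 0 ≤ c j v
  sum_smul : ∀ v, ∑ j, c j v • b j = v
  zero : ∀ j, c j 0 = 0
  lipschitz : ∀ j v w, |c j v - c j w| ≤ ‖v - w‖

theorem PositiveFrame.continuous {ι F : Type*} [Fintype ι] [NormedAddCommGroup F] [NormedSpace ℝ F]
    (P : PositiveFrame ι F) (j : ι) : Continuous (P.c j) := by
  refine (LipschitzWith.of_dist_le_mul (K := 1) fun v w => ?_).continuous
  simpa [Real.dist_eq, dist_eq_norm] using P.lipschitz j v w

theorem PositiveFrame.enorm_le {ι F : Type*} [Fintype ι] [NormedAddCommGroup F] [NormedSpace ℝ F]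
    (P : PositiveFrame ι F) (j : ι) (v : F) : ‖P.c j v‖ₑ ≤ ‖v‖ₑ := by
  rw [enorm_le_iff_norm_le]
  simpa [P.zero] using P.lipschitz j v 0

/-- The positive and negative parts of a real number. -/
def realFrame : PositiveFrame Bool ℝ where
  b s := cond s 1 (-1)
  c s v := max (cond s 1 (-1) * v) 0
  nonneg _ _ := le_max_right _ _
  sum_smul v := by
    rcases le_total 0 v with h | h <;> simp [h]
  zero := by simp
  lipschitz s v w := by
    refine (abs_max_sub_max_le_abs _ _ _).trans ?_
    cases s
    · simp only [cond_false, Real.norm_eq_abs]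
      rw [← abs_neg]
      exact le_of_eq (by congr 1; ring)
    · simp

/-- The positive and negative parts of the coordinates of a vector. -/
def euclFrame (d : ℕ) : PositiveFrame (Fin d × Bool) (Eucl d) where
  b j := cond j.2 (1 : ℝ) (-1) • EuclideanSpace.single j.1 1
  c j v := max (cond j.2 1 (-1) * v j.1) 0
  nonneg _ _ := le_max_right _ _
  sum_smul v := by
    rw [Fintype.sum_prod_type]
    ext i
    simp only [Fintype.sum_bool, cond_true, cond_false]
    rw [WithLp.ofLp_sum, Finset.sum_apply, Finset.sum_eq_single i]
    · rcases le_total 0 (v i) with h | h <;> simp [h]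
    · intro k _ hk
      simp [hk.symm]
    · simp
  zero := by simp
  lipschitz j v w := by
    refine (abs_max_sub_max_le_abs _ _ _).trans ?_
    have : |v j.1 - w j.1| ≤ ‖v - w‖ := by
      simpa using PiLp.norm_apply_le (v - w) j.1
    refine le_trans (le_of_eq ?_) this
    rcases j with ⟨i, s⟩
    cases s
    · simp only [cond_false]
      rw [← abs_neg]
      congr 1; ring
    · simp

namespace RadonVectorMeasure

variable {X : Type*} [TopologicalSpace X] [T2Space X] [MeasurableSpace X] [BorelSpace X] {U : Set X}
  {F : Type*} [NormedAddCommGroup F] [NormedSpace ℝ F] [CompleteSpace F] {ι : Type*} [Fintype ι]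

open Classical in
/-- The Radon measure `∑ j, b j • ν j`. -/
def ofMeasures (b : ι → F) (ν : ι → Measure X)
    (hν : ∀ j K, IsCompact K → K ⊆ U → ν j K < ⊤) : RadonVectorMeasure U F where
  on K := if IsCompact K ∧ K ⊆ U then ∑ j, ((ν j).restrict K).withDensityᵥ fun _ => b j else 0
  on_restrict K L hK hL hKL hLU := by
    rw [if_pos ⟨hL, hLU⟩, if_pos ⟨hK, hKL.trans hLU⟩]
    ext A hA
    rw [VectorMeasure.restrict_apply _ hK.measurableSet hA]
    simp only [_root_.sum_apply]
    refine Finset.sum_congr rfl fun j _ => ?_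
    have hiK : IntegrableOn (fun _ => b j) K (ν j) :=
      integrableOn_const (hν j K hK (hKL.trans hLU)).ne
    have hiL : IntegrableOn (fun _ => b j) L (ν j) := integrableOn_const (hν j L hL hLU).ne
    rw [withDensityᵥ_apply hiL (hA.inter hK.measurableSet), withDensityᵥ_apply hiK hA,
      Measure.restrict_restrict hA, Measure.restrict_restrict (hA.inter hK.measurableSet),
      inter_assoc, inter_eq_left.2 hKL]
  finite K hK hKU := by
    rw [if_pos ⟨hK, hKU⟩]
    refine (VectorMeasure.variation_finsetSum_le _ _ _).trans_lt ?_
    simp only [Measure.coe_finsetSum, Finset.sum_apply]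
    refine ENNReal.sum_lt_top.2 fun j _ => ?_
    have hi : IntegrableOn (fun _ => b j) K (ν j) := integrableOn_const (hν j K hK hKU).ne
    rw [Measure.variation_withDensityᵥ hi, withDensity_const]
    simpa using ENNReal.mul_lt_top enorm_lt_top (hν j K hK hKU)
  on_eq_zero K hK := if_neg hK

theorem ofMeasures_on (b : ι → F) (ν : ι → Measure X)
    (hν : ∀ j K, IsCompact K → K ⊆ U → ν j K < ⊤) {K : Set X} (hK : IsCompact K) (hKU : K ⊆ U) :
    (ofMeasures b ν hν).on K = ∑ j, ((ν j).restrict K).withDensityᵥ fun _ => b j :=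
  if_pos ⟨hK, hKU⟩

theorem ofMeasures_on_apply (b : ι → F) (ν : ι → Measure X)
    (hν : ∀ j K, IsCompact K → K ⊆ U → ν j K < ⊤) {K A : Set X} (hK : IsCompact K) (hKU : K ⊆ U)
    (hA : MeasurableSet A) :
    (ofMeasures b ν hν).on K A = ∑ j, (ν j).real (A ∩ K) • b j := by
  rw [ofMeasures_on b ν hν hK hKU]
  simp only [_root_.sum_apply]
  refine Finset.sum_congr rfl fun j _ => ?_
  have hi : IntegrableOn (fun _ => b j) K (ν j) := integrableOn_const (hν j K hK hKU).ne
  rw [withDensityᵥ_apply hi hA,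
    Measure.restrict_restrict hA, setIntegral_const]

theorem ofMeasures_pairing (b : ι → F) (ν : ι → Measure X)
    (hν : ∀ j K, IsCompact K → K ⊆ U → ν j K < ⊤) {φ : X → ℝ} (hφ : IsTestFunction U φ) :
    (ofMeasures b ν hν).pairing φ = ∑ j, (∫ x, φ x ∂ν j) • b j := by
  have hfin : ∀ j, IsFiniteMeasure ((ν j).restrict (tsupport φ)) := fun j =>
    ⟨by simpa using hν j _ hφ.2.1 hφ.2.2⟩
  have hi : ∀ j, Integrable φ (ν j) := fun j => hφ.integrable (hν j)
  rw [pairing, ofMeasures_on b ν hν hφ.2.1 hφ.2.2, VectorMeasure.integral_finsetSum_vectorMeasure]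
  · refine Finset.sum_congr rfl fun j _ => ?_
    rw [integral_withDensityᵥ_const _ _ (hi j).integrableOn,
      setIntegral_eq_integral_of_forall_compl_eq_zero]
    exact fun x hx => image_eq_zero_of_notMem_tsupport hx
  · intro j _
    rw [VectorMeasure.Integrable, Measure.variation_withDensityᵥ (integrable_const _),
      withDensity_const]
    exact (hi j).integrableOn.smul_measure (by simp)

/-- If `|ν j - ν' j| ≤ κ` for all `j` then `|∑ j, b j • (ν j - ν' j)| ≤ (∑ j, ‖b j‖) κ`. -/
theorem mass_ofMeasures_sub_le (b : ι → F) (ν ν' : ι → Measure X) (κ : Measure X)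
    (hν : ∀ j K, IsCompact K → K ⊆ U → ν j K < ⊤) (hν' : ∀ j K, IsCompact K → K ⊆ U → ν' j K < ⊤)
    {K : Set X} (hK : IsCompact K) (hKU : K ⊆ U) (hκ : κ K < ⊤)
    (h : ∀ j A, MeasurableSet A → A ⊆ K → ν j A ≤ ν' j A + κ A ∧ ν' j A ≤ ν j A + κ A) :
    (ofMeasures b ν hν - ofMeasures b ν' hν').mass K ≤ (∑ j, ‖b j‖ₑ) * κ K := by
  have key : ((ofMeasures b ν hν).on K - (ofMeasures b ν' hν').on K).variation ≤
      (∑ j, ‖b j‖ₑ) • κ.restrict K := by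
    refine VectorMeasure.variation_le_of_forall_enorm_le fun A hA => ?_
    rw [_root_.sub_apply, ofMeasures_on_apply b ν hν hK hKU hA,
      ofMeasures_on_apply b ν' hν' hK hKU hA, ← Finset.sum_sub_distrib]
    simp only [← sub_smul]
    refine (enorm_sum_le _ _).trans ?_
    rw [Measure.smul_apply, smul_eq_mul, Finset.sum_mul]
    refine Finset.sum_le_sum fun j _ => ?_
    rw [enorm_smul, mul_comm, Measure.restrict_apply hA]
    gcongr
    have hf : ∀ {m : Measure X}, m K < ⊤ → m (A ∩ K) ≠ ⊤ := fun hm =>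
      ((measure_mono inter_subset_right).trans_lt hm).ne
    have h1 := hf (hν j K hK hKU)
    have h2 := hf (hν' j K hK hKU)
    have h3 := hf hκ
    obtain ⟨e1, e2⟩ := h j (A ∩ K) (hA.inter hK.measurableSet) inter_subset_right
    rw [← ENNReal.ofReal_toReal h3, Real.enorm_eq_ofReal_abs]
    refine ENNReal.ofReal_le_ofReal (abs_sub_le_iff.2 ⟨?_, ?_⟩)
    · have := ENNReal.toReal_mono (ENNReal.add_ne_top.2 ⟨h2, h3⟩) e1
      rw [ENNReal.toReal_add h2 h3] at this
      simp only [Measure.real]; linarith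
    · have := ENNReal.toReal_mono (ENNReal.add_ne_top.2 ⟨h1, h3⟩) e2
      rw [ENNReal.toReal_add h1 h3] at this
      simp only [Measure.real]; linarith
  refine (key K).trans ?_
  simp

end RadonVectorMeasure

/-- Weak convergence of the densities `f n` to a Radon vector measure which is a combination of weak
limits of their coordinates. -/
structure FrameLimit {X F κ ι : Type*} [TopologicalSpace X] [T2Space X] [MeasurableSpace X]
    [BorelSpace X] [NormedAddCommGroup F] [NormedSpace ℝ F] [CompleteSpace F] [Fintype ι]
    (P : PositiveFrame ι F) (U : Set X) (m : Measure X) (l : Filter κ) (f : κ → X → F)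
    (μ : RadonVectorMeasure U F) where
  ν : ι → Measure X
  weakLimit : ∀ j, WeakLimit U m l (fun n x => P.c j (f n x)) (ν j)
  eq : μ = RadonVectorMeasure.ofMeasures P.b ν fun j => (weakLimit j).lt_top

section FrameLimits

variable {X F κ ι : Type*} [MetricSpace X] [MeasurableSpace X]
  [BorelSpace X] [NormedAddCommGroup F] [NormedSpace ℝ F] [CompleteSpace F] [Fintype ι]
  {P : PositiveFrame ι F} {U : Set X} {m : Measure X} {f g : κ → X → F}

/-- The parts `P.c j (f n)` may be nonlinear in `f n`, so their weak convergence would not follow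
from that of `f n`; the ultrafilter selects limits for all of them. -/
theorem LocBddL1.exists_frameLimit [LocallyCompactSpace X] (P : PositiveFrame ι F)
    (hU : IsOpen U) (l : Ultrafilter κ) (hb : LocBddL1 U m l f)
    (hf : ∀ n, AEStronglyMeasurable (f n) m) : ∃ μ, Nonempty (FrameLimit P U m l f μ) := by
  have h : ∀ j, ∃ ν, WeakLimit U m l (fun n x => P.c j (f n x)) ν := fun j =>
    (hb.mono fun n x => P.enorm_le j (f n x)).exists_weakLimit hU l
      (fun n => (P.continuous j).comp_aestronglyMeasurable (hf n)) fun n x => P.nonneg j _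
  choose ν hν using h
  exact ⟨_, ⟨ν, hν, rfl⟩⟩

theorem FrameLimit.tendsto {l : Filter κ} {μ : RadonVectorMeasure U F}
    (h : FrameLimit P U m l f μ) (hb : LocBddL1 U m l f)
    (hf : ∀ n, AEStronglyMeasurable (f n) m) {φ : X → ℝ} (hφ : IsTestFunction U φ) :
    Tendsto (fun n => ∫ x, φ x • f n x ∂m) l (𝓝 (μ.pairing φ)) := by
  rw [h.eq, RadonVectorMeasure.ofMeasures_pairing _ _ _ hφ]
  refine (tendsto_finsetSum _ fun j _ => ((h.weakLimit j).tendsto φ hφ).smul_const (P.b j)).congr'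
    ?_
  have hi : ∀ᶠ n in l, ∀ j, Integrable (fun x => φ x * P.c j (f n x)) m :=
    eventually_all.2 fun j => (hb.mono fun n x => P.enorm_le j (f n x)).eventually_integrable_smul
      (fun n => (P.continuous j).comp_aestronglyMeasurable (hf n)) hφ
  filter_upwards [hi] with n hn
  simp only [← integral_smul_const]
  rw [← integral_finsetSum _ fun j _ => (hn j).smul_const (P.b j)]
  congr with x
  simp only [mul_smul, ← Finset.smul_sum, P.sum_smul]

/-- The coordinates are `1`-Lipschitz, so those of `f n` and `g n` differ by at most `‖f n - g n‖`.
A weak limit `κ` of the latter therefore dominates the differences of the limit measures, and `κ K ≤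
C`. -/
theorem FrameLimit.mass_sub_le [LocallyCompactSpace X] (hU : IsOpen U) {l : Ultrafilter κ}
    {μ μ' : RadonVectorMeasure U F}
    (h : FrameLimit P U m l f μ) (h' : FrameLimit P U m l g μ') (hbf : LocBddL1 U m l f)
    (hbg : LocBddL1 U m l g)
    (hf : ∀ n, AEStronglyMeasurable (f n) m) (hg : ∀ n, AEStronglyMeasurable (g n) m)
    {K L : Set X} (hK : IsCompact K) (hLU : L ⊆ U) (hKL : K ⊆ interior L) {C : ℝ≥0∞}
    (hC : ∀ᶠ n in l, ∫⁻ x in L, ‖f n x - g n x‖ₑ ∂m ≤ C) :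
    (μ - μ').mass K ≤ (∑ j, ‖P.b j‖ₑ) * C := by
  have hb : LocBddL1 U m l fun n x => ‖f n x - g n x‖ := by
    intro K hK hKU
    obtain ⟨A, hA, hAn⟩ := hbf K hK hKU
    obtain ⟨B, hB, hBn⟩ := hbg K hK hKU
    refine ⟨A + B, ENNReal.add_ne_top.2 ⟨hA, hB⟩, ?_⟩
    filter_upwards [hAn, hBn] with n h1 h2
    calc ∫⁻ x in K, ‖‖f n x - g n x‖‖ₑ ∂m ≤ ∫⁻ x in K, ‖f n x‖ₑ + ‖g n x‖ₑ ∂m :=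
          lintegral_mono fun x => by rw [enorm_norm]; exact enorm_sub_le
      _ = ∫⁻ x in K, ‖f n x‖ₑ ∂m + ∫⁻ x in K, ‖g n x‖ₑ ∂m :=
          lintegral_add_left' (hf n).restrict.enorm _
      _ ≤ A + B := add_le_add h1 h2
  have hm : ∀ n, AEStronglyMeasurable (fun x => ‖f n x - g n x‖) m := fun n =>
    ((hf n).sub (hg n)).norm
  obtain ⟨κ, hκ⟩ := hb.exists_weakLimit hU l hm fun n x => norm_nonneg _
  have hKU : K ⊆ U := hKL.trans (interior_subset.trans hLU)
  have hκK : κ K ≤ C := hκ.measure_le hm hK hLU hKL (by simpa using hC)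
  refine le_trans ?_ (mul_le_mul_right hκK _)
  rw [h.eq, h'.eq]
  refine RadonVectorMeasure.mass_ofMeasures_sub_le _ _ _ κ _ _ hK hKU (hκ.lt_top K hK hKU) ?_
  intro j A hA hAK
  have b₁ := hbf.mono fun n x => P.enorm_le j (f n x)
  have b₂ := hbg.mono fun n x => P.enorm_le j (g n x)
  have m₁ : ∀ n, AEStronglyMeasurable (fun x => P.c j (f n x)) m :=
    fun n => (P.continuous j).comp_aestronglyMeasurable (hf n)
  have m₂ : ∀ n, AEStronglyMeasurable (fun x => P.c j (g n x)) m :=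
    fun n => (P.continuous j).comp_aestronglyMeasurable (hg n)
  constructor
  · refine (h.weakLimit j).measure_le_add hU (h'.weakLimit j) hκ m₁ m₂ hm b₁ b₂ hb ?_ hK hKU hA hAK
    intro n x
    linarith [(abs_le.1 (P.lipschitz j (f n x) (g n x))).2]
  · refine (h'.weakLimit j).measure_le_add hU (h.weakLimit j) hκ m₂ m₁ hm b₂ b₁ hb ?_ hK hKU hA hAK
    intro n x
    linarith [(abs_le.1 (P.lipschitz j (f n x) (g n x))).1]

end FrameLimits

end VectorMeasures

/-! ### Extraction of one subsequence for all points and test functions -/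

section Extraction

/-- A countable product of closed balls is sequentially compact, which gives convergence on `S`; the
approximation hypothesis makes the values at every other parameter Cauchy. -/
theorem exists_subseq_tendsto_of_countable {P E : Type*} [NormedAddCommGroup E] [ProperSpace E]
    (T : ℕ → P → E) {S : Set P} (hS : S.Countable)
    (hb : ∀ s ∈ S, ∃ R : ℝ, ∀ᶠ n in atTop, ‖T n s‖ ≤ R)
    (hd : ∀ p, ∀ η > 0, ∃ s ∈ S, ∀ᶠ n in atTop, ‖T n p - T n s‖ ≤ η) :
    ∃ k : ℕ → ℕ, StrictMono k ∧ ∀ p, ∃ L, Tendsto (fun n => T (k n) p) atTop (𝓝 L) := by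
  -- Membership in the compact box is needed for every `n`, so the finitely many initial norms are
  -- added to the eventual bound.
  have hb' : ∀ s : S, ∃ R : ℝ, ∀ n, ‖T n s‖ ≤ R := fun s => by
    obtain ⟨R, hR⟩ := hb s s.2
    obtain ⟨N, hN⟩ := eventually_atTop.1 hR
    refine ⟨|R| + ∑ i ∈ Finset.range N, ‖T i s‖, fun n => ?_⟩
    rcases le_or_gt N n with h | h
    · have : 0 ≤ ∑ i ∈ Finset.range N, ‖T i s‖ := Finset.sum_nonneg fun _ _ => norm_nonneg _
      linarith [hN n h, le_abs_self R]
    · have := Finset.single_le_sum (f := fun i => ‖T i s‖) (fun _ _ => norm_nonneg _)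
        (Finset.mem_range.2 h)
      linarith [abs_nonneg R]
  choose R hR using hb'
  have : Countable S := hS.to_subtype
  have hc : IsCompact (univ.pi fun s : S => closedBall (0 : E) (R s)) :=
    isCompact_univ_pi fun s => isCompact_closedBall _ _
  obtain ⟨a, -, k, hk, ha⟩ := hc.tendsto_subseq (x := fun n (s : S) => T n s)
    fun n s _ => by simpa using hR s n
  refine ⟨k, hk, fun p => cauchySeq_tendsto_of_complete ?_⟩
  refine Metric.cauchySeq_iff'.2 fun ε hε => ?_
  obtain ⟨s, hs, hps⟩ := hd p (ε / 4) (by positivity)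
  have h1 := (tendsto_pi_nhds.1 ha ⟨s, hs⟩).cauchySeq
  obtain ⟨N₁, hN₁⟩ := Metric.cauchySeq_iff.1 h1 (ε / 4) (by positivity)
  obtain ⟨N₂, hN₂⟩ := eventually_atTop.1 (hk.tendsto_atTop.eventually hps)
  refine ⟨max N₁ N₂, fun n hn => ?_⟩
  have e1 := hN₂ n (le_of_max_le_right hn)
  have e2 := hN₂ (max N₁ N₂) (le_max_right _ _)
  have e3 := hN₁ n (le_of_max_le_left hn) (max N₁ N₂) (le_max_left _ _)
  simp only [Function.comp, dist_eq_norm] at e3 ⊢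
  calc ‖T (k n) p - T (k (max N₁ N₂)) p‖
      = ‖(T (k n) p - T (k n) s) + (T (k n) s - T (k (max N₁ N₂)) s) -
          (T (k (max N₁ N₂)) p - T (k (max N₁ N₂)) s)‖ := by congr 1; abel
    _ ≤ ‖T (k n) p - T (k n) s‖ + ‖T (k n) s - T (k (max N₁ N₂)) s‖ +
          ‖T (k (max N₁ N₂)) p - T (k (max N₁ N₂)) s‖ :=
        (norm_sub_le _ _).trans (add_le_add_left (norm_add_le _ _) _)
    _ < ε := by linarith

variable {X : Type*} [MetricSpace X] [LocallyCompactSpace X] [SecondCountableTopology X]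

/-- The approximants share one compact set `K` with `φ`, so that uniform closeness can be multiplied
by a local `L¹` bound on `K`. They come from separability of the continuous functions supported in
each member of a compact exhaustion. -/
theorem exists_countable_testFunctions {U : Set X} (hU : IsOpen U) :
    ∃ S : Set (X → ℝ), S.Countable ∧ (∀ ψ ∈ S, IsTestFunction U ψ) ∧
      ∀ φ, IsTestFunction U φ → ∃ K, IsCompact K ∧ K ⊆ U ∧ tsupport φ ⊆ K ∧
        ∀ η > 0, ∃ ψ ∈ S, tsupport ψ ⊆ K ∧ ∀ x, ‖φ x - ψ x‖ ≤ η := by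
  have : LocallyCompactSpace U := hU.locallyCompactSpace
  let E : CompactExhaustion U := default
  let K : ℕ → Set X := fun n => Subtype.val '' E n
  have hK : ∀ n, IsCompact (K n) := fun n => (E.isCompact n).image continuous_subtype_val
  have hKU : ∀ n, K n ⊆ U := fun n => Subtype.coe_image_subset _ _
  let A : ℕ → Set C(X, ℝ) := fun n => {f | tsupport f ⊆ K n}
  have hD : ∀ n, ∃ D : Set (A n), D.Countable ∧ Dense D := fun n =>
    TopologicalSpace.exists_countable_dense (A n)
  choose D hDc hDd using hD
  refine ⟨⋃ n, (fun f : A n => (f.1 : X → ℝ)) '' D n,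
    countable_iUnion fun n => (hDc n).image _, ?_, ?_⟩
  · intro ψ hψ
    obtain ⟨n, f, -, rfl⟩ := mem_iUnion.1 hψ
    exact ⟨f.1.continuous, (hK n).of_isClosed_subset (isClosed_tsupport _) f.2,
      f.2.trans (hKU n)⟩
  · intro φ hφ
    obtain ⟨n, hn⟩ := E.exists_superset_of_isCompact
      (Topology.IsInducing.subtypeVal.isCompact_preimage' hφ.2.1 (by simpa using hφ.2.2))
    have hφK : tsupport φ ⊆ K n := fun x hx => ⟨⟨x, hφ.2.2 hx⟩, hn hx, rfl⟩
    refine ⟨K n, hK n, hKU n, hφK, fun η hη => ?_⟩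
    let f : A n := ⟨⟨φ, hφ.1⟩, hφK⟩
    have hev : ∀ᶠ g : C(X, ℝ) in 𝓝 f.1, ∀ x ∈ K n, dist (φ x) (g x) < η :=
      Metric.tendstoUniformlyOn_iff.1
        (ContinuousMap.tendsto_iff_forall_isCompact_tendstoUniformlyOn.1 tendsto_id (K n) (hK n)) η hη
    obtain ⟨g, hg, hgD⟩ := (hDd n).exists_mem_open isOpen_interior
      ⟨f, mem_interior_iff_mem_nhds.2 (continuous_subtype_val.continuousAt.eventually hev)⟩
    refine ⟨g.1, mem_iUnion.2 ⟨n, g, hg, rfl⟩, g.2, fun x => ?_⟩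
    by_cases hx : x ∈ K n
    · rw [← dist_eq_norm]
      exact (interior_subset hgD x hx).le
    · rw [image_eq_zero_of_notMem_tsupport fun h => hx (hφK h),
        image_eq_zero_of_notMem_tsupport fun h => hx (g.2 h)]
      simpa using hη.le

theorem exists_subseq_integral_smul_tendsto [MeasurableSpace X] [BorelSpace X] {F Z : Type*}
    [NormedAddCommGroup F] [NormedSpace ℝ F] [ProperSpace F] [TopologicalSpace Z]
    [TopologicalSpace.SeparableSpace Z] {U : Set X} (hU : IsOpen U) {m : Measure X}
    {g : ℕ → Z → X → F} (hg : ∀ n z, AEStronglyMeasurable (g n z) m)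
    (hb : ∀ z, LocBddL1 U m atTop fun n => g n z)
    (hc : ∀ K, IsCompact K → K ⊆ U → ∀ z, ∀ η : ℝ, 0 < η → ∀ᶠ z' in 𝓝 z, ∀ᶠ n in atTop,
      ∫⁻ x in K, ‖g n z x - g n z' x‖ₑ ∂m ≤ ENNReal.ofReal η) :
    ∃ k : ℕ → ℕ, StrictMono k ∧ ∀ z φ, IsTestFunction U φ →
      ∃ L, Tendsto (fun n => ∫ x, φ x • g (k n) z x ∂m) atTop (𝓝 L) := by
  obtain ⟨S, hSc, hS, happ⟩ := exists_countable_testFunctions hU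
  obtain ⟨D, hDc, hDd⟩ := TopologicalSpace.exists_countable_dense Z
  let T : ℕ → Z × {φ : X → ℝ // IsTestFunction U φ} → F := fun n p =>
    ∫ x, p.2.1 x • g n p.1 x ∂m
  have hcount : (D ×ˢ (Subtype.val ⁻¹' S : Set {φ : X → ℝ // IsTestFunction U φ})).Countable :=
    hDc.prod (hSc.preimage Subtype.val_injective)
  suffices h : ∃ k : ℕ → ℕ, StrictMono k ∧ ∀ p, ∃ L, Tendsto (fun n => T (k n) p) atTop (𝓝 L) by
    obtain ⟨k, hk, h⟩ := h
    exact ⟨k, hk, fun z φ hφ => h (z, ⟨φ, hφ⟩)⟩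
  refine exists_subseq_tendsto_of_countable T hcount ?_ ?_
  · rintro ⟨z, φ, hφ⟩ -
    obtain ⟨C, hC, hn⟩ := hb z _ hφ.2.1 hφ.2.2
    obtain ⟨B, hB0, hB⟩ := hφ.exists_bound
    exact ⟨B * C.toReal, hn.mono fun n hn =>
      norm_integral_smul_le_of_support_subset (hg n z) hC hB0 hB (subset_tsupport φ) hn⟩
  · rintro ⟨z, φ, hφ⟩ η hη
    obtain ⟨K, hK, hKU, hφK, hψ⟩ := happ φ hφ
    obtain ⟨B, hB0, hB⟩ := hφ.exists_bound
    -- Half of `η` is spent on moving `z` to the dense set, half on replacing `φ` by `ψ`; the `+ 1`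
    -- in both denominators avoids division by zero.
    obtain ⟨z', hzD, hz'⟩ := hDd.exists_mem_open isOpen_interior
      ⟨z, mem_interior_iff_mem_nhds.2 (hc K hK hKU z (η / (2 * (B + 1))) (by positivity))⟩
    have hz'' := interior_subset hz'
    obtain ⟨C, hC, hn⟩ := hb z' K hK hKU
    obtain ⟨ψ, hψS, hψK, hψφ⟩ := hψ (η / (2 * (C.toReal + 1))) (by positivity)
    refine ⟨(z', ⟨ψ, hS ψ hψS⟩), ⟨hzD, hψS⟩, ?_⟩
    filter_upwards [hz'', hn, (hb z).eventually_integrable_smul (hg · z) hφ,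
      (hb z').eventually_integrable_smul (hg · z') hφ,
      (hb z').eventually_integrable_smul (hg · z') (hS ψ hψS)] with n e1 e2 i1 i2 i3
    have hs : Function.support (fun x => φ x - ψ x) ⊆ K := fun x hx => by
      by_contra hxK
      apply hx
      simp [image_eq_zero_of_notMem_tsupport fun h => hxK (hφK h),
        image_eq_zero_of_notMem_tsupport fun h => hxK (hψK h)]
    have n1 := norm_integral_smul_le_of_support_subset (φ := φ) ((hg n z).sub (hg n z'))
      ENNReal.ofReal_ne_top hB0 hB ((subset_tsupport φ).trans hφK) e1
    have n2 := norm_integral_smul_le_of_support_subset (hg n z') hC (by positivity) hψφ hs e2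
    have hsplit : T n (z, ⟨φ, hφ⟩) - T n (z', ⟨ψ, hS ψ hψS⟩) =
        (∫ x, φ x • (g n z - g n z') x ∂m) + ∫ x, (φ x - ψ x) • g n z' x ∂m := by
      simp only [T, Pi.sub_apply, smul_sub, sub_smul]
      rw [integral_sub i1 i2, integral_sub i2 i3]
      abel
    rw [hsplit]
    refine (norm_add_le _ _).trans ((add_le_add n1 n2).trans ?_)
    rw [ENNReal.toReal_ofReal (by positivity)]
    have hC0 : 0 ≤ C.toReal := ENNReal.toReal_nonneg
    have a1 : B * (η / (2 * (B + 1))) ≤ η / 2 := by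
      rw [mul_div_assoc', div_le_div_iff₀ (by positivity) (by positivity)]
      nlinarith
    have a2 : η / (2 * (C.toReal + 1)) * C.toReal ≤ η / 2 := by
      rw [div_mul_eq_mul_div, div_le_div_iff₀ (by positivity) (by positivity)]
      nlinarith
    linarith

end Extraction

/-! ### Difference quotients of functions of bounded variation -/

section BoundedVariation

variable {d : ℕ}

/-- The matrix field with rows `ψ_i e` turns the divergences in `gradientVariation` into a single
directional derivative. -/
theorem fderiv_apply_eq_divergence {ψ : Eucl d → Eucl d} (hψ : Differentiable ℝ ψ) (e x : Eucl d)
    (i : Fin d) : divergence (fun x => ψ x i • e) x = fderiv ℝ ψ x e i := by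
  have h1 : ∀ w, fderiv ℝ (fun x => ψ x i • e) x w = (fderiv ℝ ψ x w i) • e := fun w => by
    have h2 : HasFDerivAt (fun x => ψ x i) ((EuclideanSpace.proj i).comp (fderiv ℝ ψ x)) x :=
      (EuclideanSpace.proj (𝕜 := ℝ) i).hasFDerivAt.comp x (hψ x).hasFDerivAt
    rw [(h2.smul_const e).fderiv]
    simp
  have he : e = ∑ j, e j • EuclideanSpace.single j (1 : ℝ) := by
    ext k
    simp [Finset.sum_apply, Pi.single_apply]
  conv_rhs => rw [he, map_sum]
  simp only [divergence, h1, map_smul]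
  simp [Finset.sum_apply, mul_comm]

/-- The defining inequality of the variation, tested with the derivative of `ψ` in one direction. -/
theorem abs_integral_inner_fderiv_le {O : Set (Eucl d)} (hO : IsOpen O) {f : Eucl d → Eucl d}
    (hG : gradientVariation O f ≠ ⊤) {ψ : Eucl d → Eucl d} (hψ : ContDiff ℝ ∞ ψ)
    (hc : HasCompactSupport ψ) (hs : tsupport ψ ⊆ O) (h1 : ∀ x, ‖ψ x‖ ≤ 1) (h : Eucl d) :
    |∫ x, inner ℝ (O.indicator f x) (fderiv ℝ ψ x h)| ≤ (gradientVariation O f).toReal * ‖h‖ := by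
  have key : ∀ e : Eucl d, ‖e‖ = 1 →
      ∫ x, inner ℝ (O.indicator f x) (fderiv ℝ ψ x e) ≤ (gradientVariation O f).toReal := by
    intro e he
    have hΦ : ∀ i, ContDiff ℝ ∞ (fun x => ψ x i • e) ∧ HasCompactSupport (fun x => ψ x i • e) ∧
        tsupport (fun x => ψ x i • e) ⊆ O := fun i => by
      have hsub : Function.support (fun x => ψ x i • e) ⊆ Function.support ψ := by
        intro x hx h0
        apply hx
        simp [h0]
      refine ⟨?_, hc.mono hsub, (closure_mono hsub).trans hs⟩
      exact ((EuclideanSpace.proj (𝕜 := ℝ) i).contDiff.comp hψ).smul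
        contDiff_const
    -- The Frobenius norm of the matrix with rows `ψ_i e` is `‖ψ‖ ‖e‖ = ‖ψ‖`, so the test field is
    -- admissible.
    have hn : ∀ x, ∑ i, ‖ψ x i • e‖ ^ 2 ≤ 1 := fun x => by
      simp only [norm_smul, he, mul_one]
      rw [← EuclideanSpace.norm_sq_eq]
      exact pow_le_one₀ (norm_nonneg _) (h1 x)
    have h3 : ENNReal.ofReal (∫ x in O, ∑ i, f x i * divergence (fun x => ψ x i • e) x) ≤
        gradientVariation O f :=
      le_iSup_of_le (fun i x => ψ x i • e) (le_iSup_of_le hΦ (le_iSup_of_le hn le_rfl))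
    have h4 := (ENNReal.ofReal_le_iff_le_toReal hG).1 h3
    refine le_trans (le_of_eq ?_) h4
    rw [← integral_indicator hO.measurableSet]
    congr with x
    by_cases hx : x ∈ O
    · simp only [hx, indicator_of_mem,
        fderiv_apply_eq_divergence (hψ.differentiable (by simp)), PiLp.inner_apply]
      simp [mul_comm]
    · simp [hx]
  rcases eq_or_ne h 0 with rfl | hh
  · simp
  have hpos : 0 < ‖h‖ := norm_pos_iff.2 hh
  have hsc : ∀ s : ℝ, ∫ x, inner ℝ (O.indicator f x) (fderiv ℝ ψ x (s • h)) =
      s * ∫ x, inner ℝ (O.indicator f x) (fderiv ℝ ψ x h) := fun s => by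
    rw [← integral_const_mul]
    simp only [map_smul, inner_smul_right]
  have k1 := key (‖h‖⁻¹ • h) (by rw [norm_smul, norm_inv, norm_norm, inv_mul_cancel₀ hpos.ne'])
  have k2 := key ((-‖h‖⁻¹) • h)
    (by rw [norm_smul, norm_neg, norm_inv, norm_norm, inv_mul_cancel₀ hpos.ne'])
  rw [hsc] at k1 k2
  rw [abs_le]
  constructor
  · have := mul_le_mul_of_nonneg_right k2 hpos.le
    field_simp at this
    linarith
  · have := mul_le_mul_of_nonneg_right k1 hpos.le
    field_simp at this
    linarith

theorem norm_add_smul_sub_le {E : Type*} [NormedAddCommGroup E] [NormedSpace ℝ E] {a b : E} {r : ℝ}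
    (ha : ‖a‖ ≤ r) (hb : ‖b‖ ≤ r) {s : ℝ} (hs : s ∈ Icc (0 : ℝ) 1) : ‖b + s • (a - b)‖ ≤ r := by
  have h := (convex_closedBall (0 : E) r).add_smul_sub_mem (x := b) (y := a) (by simpa using hb)
    (by simpa using ha) hs
  simpa using h

/-- The difference quotient estimate of `BV`, in dual form. -/
theorem integral_inner_translate_sub_le {O : Set (Eucl d)} (hO : IsOpen O) {f : Eucl d → Eucl d}
    (hf : IntegrableOn f O) (hG : gradientVariation O f ≠ ⊤) {φ : Eucl d → Eucl d}
    (hφ : ContDiff ℝ ∞ φ) (hc : HasCompactSupport φ) (h1 : ∀ x, ‖φ x‖ ≤ 1) {r : ℝ}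
    (hs : ∀ x ∈ tsupport φ, ∀ w : Eucl d, ‖w‖ ≤ r → x + w ∈ O) {a b : Eucl d} (ha : ‖a‖ ≤ r)
    (hb : ‖b‖ ≤ r) :
    ∫ x, inner ℝ (O.indicator f (x + a) - O.indicator f (x + b)) (φ x) ≤
      (gradientVariation O f).toReal * ‖a - b‖ := by
  have hF : Integrable (O.indicator f) := (integrable_indicator_iff hO.measurableSet).2 hf
  set F := O.indicator f
  set h := a - b with hh
  have hdiff : Differentiable ℝ φ := hφ.differentiable (by simp)
  have hcont : Continuous (fderiv ℝ φ) := hφ.continuous_fderiv (by simp)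
  obtain ⟨C, hC⟩ := (hc.fderiv ℝ).exists_bound_of_continuous hcont
  have hin : ∀ w, Integrable fun x => inner ℝ (F x) (φ (x - w)) := fun w =>
    hF.norm.mono (hF.1.inner (hφ.continuous.comp
      (continuous_id.sub continuous_const)).aestronglyMeasurable)
      (Eventually.of_forall fun x => by
        refine (norm_inner_le_norm _ _).trans ?_
        rw [norm_norm]
        exact mul_le_of_le_one_right (norm_nonneg _) (h1 _))
  -- The translation is moved onto the test field, and `H` interpolates along the segment from `b`
  -- to `a`. Its derivative pairs `F` with a directional derivative of a translate of `φ`, which the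
  -- variation controls, and the mean value inequality concludes.
  let H : ℝ → ℝ := fun s => ∫ x, inner ℝ (F x) (φ (x - (b + s • h)))
  have hpt : ∀ (x : Eucl d) (s : ℝ), HasDerivAt (fun s : ℝ => inner ℝ (F x) (φ (x - (b + s • h))))
      (inner ℝ (F x) (fderiv ℝ φ (x - (b + s • h)) (-h))) s := fun x s => by
    have e1 : HasDerivAt (fun s : ℝ => x - (b + s • h)) (-h) s := by
      simpa using (((hasDerivAt_id s).smul_const h).const_add b).const_sub x
    have e2 := (hdiff (x - (b + s • h))).hasFDerivAt.comp_hasDerivAt s e1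
    exact ((innerSL ℝ (F x)).hasFDerivAt.comp_hasDerivAt s e2)
  have hH : ∀ s, HasDerivAt H (∫ x, inner ℝ (F x) (fderiv ℝ φ (x - (b + s • h)) (-h))) s := by
    intro s
    refine (hasDerivAt_integral_of_dominated_loc_of_deriv_le (s := univ) (x₀ := s)
      (F := fun (s : ℝ) x => inner ℝ (F x) (φ (x - (b + s • h))))
      (F' := fun (s : ℝ) x => inner ℝ (F x) (fderiv ℝ φ (x - (b + s • h)) (-h)))
      (bound := fun x => ‖F x‖ * (C * ‖h‖)) univ_mem
      (Eventually.of_forall fun s : ℝ => (hin (b + s • h)).1) (hin _) ?_ ?_ (hF.norm.mul_const _) ?_).2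
    · exact hF.1.inner ((hcont.comp (continuous_id.sub continuous_const)).clm_apply
        continuous_const).aestronglyMeasurable
    · refine Eventually.of_forall fun x s _ => (norm_inner_le_norm _ _).trans ?_
      gcongr
      refine ((fderiv ℝ φ _).le_opNorm _).trans ?_
      rw [norm_neg]
      gcongr
      exact hC _
    · exact Eventually.of_forall fun x s _ => hpt x s
  have hbound : ∀ s ∈ Ico (0 : ℝ) 1,
      ‖∫ x, inner ℝ (F x) (fderiv ℝ φ (x - (b + s • h)) (-h))‖ ≤
        (gradientVariation O f).toReal * ‖h‖ := by
    intro s hs01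
    let w := b + s • h
    have hw : ‖w‖ ≤ r := norm_add_smul_sub_le ha hb (Ico_subset_Icc_self hs01)
    have e := abs_integral_inner_fderiv_le hO hG (ψ := fun x => φ (x - w))
      (hφ.comp (contDiff_id.sub contDiff_const)) (hc.comp_homeomorph (Homeomorph.subRight w)) ?_
      (fun x => h1 _) (-h)
    · rw [norm_neg] at e
      rw [Real.norm_eq_abs]
      simpa only [fderiv_comp_sub] using e
    · intro x hx
      have h2 : x - w ∈ tsupport φ := by
        have := tsupport_comp_subset_preimage φ (Homeomorph.subRight w).continuous hx
        simpa using this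
      simpa using hs _ h2 w hw
  have hmv := norm_image_sub_le_of_norm_deriv_le_segment_01'
    (fun s _ => (hH s).hasDerivWithinAt) hbound
  have htr : ∀ w, ∫ x, inner ℝ (F (x + w)) (φ x) = ∫ x, inner ℝ (F x) (φ (x - w)) := fun w => by
    rw [← integral_add_right_eq_self (fun x => inner ℝ (F x) (φ (x - w))) w]
    simp
  have hin' : ∀ w, Integrable fun x => inner ℝ (F (x + w)) (φ x) := fun w => by
    simpa using (hin w).comp_add_right w
  simp only [inner_sub_left]
  rw [integral_sub (hin' a) (hin' b), htr, htr]
  have e1 : H 1 = ∫ x, inner ℝ (F x) (φ (x - a)) := by simp [H, hh]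
  have e0 : H 0 = ∫ x, inner ℝ (F x) (φ (x - b)) := by simp [H]
  rw [← e1, ← e0]
  exact (le_abs_self _).trans hmv

/-- A measurable field which is bounded by `1` and supported in a compact set is an almost
everywhere limit of smooth fields with the same bound and supported nearby. -/
theorem exists_smooth_approx {s : Eucl d → Eucl d} (hs : AEStronglyMeasurable s) {K : Set (Eucl d)}
    (hK : IsCompact K) (h1 : ∀ x, ‖s x‖ ≤ 1) (h0 : ∀ x, x ∉ K → s x = 0) {r : ℝ} (hr : 0 < r) :
    ∃ φ : ℕ → Eucl d → Eucl d, (∀ n, ContDiff ℝ ∞ (φ n) ∧ (∀ x, ‖φ n x‖ ≤ 1) ∧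
      tsupport (φ n) ⊆ cthickening r K) ∧
      ∀ᵐ x, Tendsto (fun n => φ n x) atTop (𝓝 (s x)) := by
  have hsK : IntegrableOn s K := by
    refine IntegrableOn.of_bound hK.measure_lt_top hs.restrict 1 (Eventually.of_forall h1)
  have hsi : Integrable s := (integrableOn_iff_integrable_of_support_subset fun x hx => by
    by_contra h; exact hx (h0 x h)).1 hsK
  -- The radii shrink to zero with fixed ratio `2`; a bounded ratio is what a.e. convergence of the
  -- mollifications requires.
  let β : ℕ → ContDiffBump (0 : Eucl d) := fun n =>
    { rIn := r / (2 * (n + 1)), rOut := r / (n + 1), rIn_pos := by positivity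
      rIn_lt_rOut := by gcongr; linarith [(n.cast_nonneg : (0 : ℝ) ≤ n)] }
  have hout : ∀ n, (β n).rOut ≤ r := fun n =>
    div_le_self hr.le (by linarith [(n.cast_nonneg : (0 : ℝ) ≤ n)])
  refine ⟨fun n => convolution ((β n).normed volume) s (ContinuousLinearMap.lsmul ℝ ℝ) volume,
    fun n => ⟨?_, fun x => ?_, ?_⟩, ?_⟩
  · exact (β n).hasCompactSupport_normed.contDiff_convolution_left _ (β n).contDiff_normed
      hsi.locallyIntegrable
  · simp only [convolution_def]
    calc ‖∫ t, ContinuousLinearMap.lsmul ℝ ℝ ((β n).normed volume t) (s (x - t))‖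
        ≤ ∫ t, (β n).normed volume t := by
          refine norm_integral_le_of_norm_le (β n).integrable_normed
            (Eventually.of_forall fun t => ?_)
          rw [ContinuousLinearMap.lsmul_apply, norm_smul,
            Real.norm_of_nonneg ((β n).nonneg_normed t)]
          exact mul_le_of_le_one_right ((β n).nonneg_normed t) (h1 _)
      _ = 1 := (β n).integral_normed
  · refine closure_minimal ?_ isClosed_cthickening
    refine (support_convolution_subset _).trans ?_
    rw [(β n).support_normed_eq]
    rintro _ ⟨x, hx, y, hy, rfl⟩
    have hyK : y ∈ K := by by_contra h; exact hy (h0 y h)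
    refine mem_cthickening_of_dist_le _ y r K hyK ?_
    have := (mem_ball_zero_iff.1 hx).le.trans (hout n)
    simpa [dist_eq_norm] using this
  · refine ContDiffBump.ae_convolution_tendsto_right_of_locallyIntegrable (K := 2) ?_ ?_
      hsi.locallyIntegrable
    · exact tendsto_const_nhds.div_atTop
        (tendsto_atTop_add_const_right _ _ tendsto_natCast_atTop_atTop)
    · refine Eventually.of_forall fun n => le_of_eq ?_
      change r / (n + 1) = 2 * (r / (2 * (n + 1)))
      field_simp

/-- The `L¹` norm of the increment `g` on `K` is its pairing with the field `g / ‖g‖` on `K`. Smooth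
approximations of this field fall under the dual estimate, and dominated convergence gives the bound
with the same constant. -/
theorem eLpNorm_translate_sub_le_gradientVariation {O : Set (Eucl d)} (hO : IsOpen O)
    {f : Eucl d → Eucl d} (hf : IntegrableOn f O) {K : Set (Eucl d)} (hK : IsCompact K) {δ : ℝ}
    (hKO : thickening δ K ⊆ O) {a b : Eucl d} (ha : ‖a‖ < δ) (hb : ‖b‖ < δ) :
    eLpNorm (fun x => f (x + a) - f (x + b)) 1 (volume.restrict K) ≤
      gradientVariation O f * ‖a - b‖ₑ := by
  rcases eq_or_ne a b with rfl | hab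
  · simp
  by_cases hG : gradientVariation O f = ⊤
  · rw [hG, ENNReal.top_mul (by simpa [sub_eq_zero] using hab)]
    exact le_top
  have hF : Integrable (O.indicator f) := (integrable_indicator_iff hO.measurableSet).2 hf
  set F := O.indicator f with hFdef
  let g : Eucl d → Eucl d := fun x => F (x + a) - F (x + b)
  have hg : Integrable g := (hF.comp_add_right a).sub (hF.comp_add_right b)
  have hmem : ∀ x ∈ K, ∀ w : Eucl d, ‖w‖ < δ → x + w ∈ O := fun x hx w hw =>
    hKO (mem_thickening_iff.2 ⟨x, hx, by simpa [dist_eq_norm] using hw⟩)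
  have hgK : ∀ x ∈ K, g x = f (x + a) - f (x + b) := fun x hx => by
    simp only [g, hFdef, indicator_of_mem (hmem x hx a ha), indicator_of_mem (hmem x hx b hb)]
  let s : Eucl d → Eucl d := K.indicator fun x => ‖g x‖⁻¹ • g x
  have hs : AEStronglyMeasurable s :=
    (hg.1.norm.aemeasurable.inv.aestronglyMeasurable.smul hg.1).indicator hK.measurableSet
  have hs1 : ∀ x, ‖s x‖ ≤ 1 := fun x => by
    by_cases hx : x ∈ K
    · simp only [s, indicator_of_mem hx, norm_smul, norm_inv, norm_norm]
      exact inv_mul_le_one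
    · simp [s, hx]
  -- The gap between `ρ` and `δ` leaves room for mollification: a field supported within `(δ - ρ) /
  -- 2` of `K` still lies in `O` after shifts of length `ρ`.
  obtain ⟨ρ, hρ1, hρ2⟩ := exists_between (max_lt ha hb)
  obtain ⟨φ, hφ, hlim⟩ := exists_smooth_approx hs hK hs1 (fun x hx => by simp [s, hx])
    (r := (δ - ρ) / 2) (by linarith)
  have hle : ∀ n, ∫ x, inner ℝ (g x) (φ n x) ≤ (gradientVariation O f).toReal * ‖a - b‖ := by
    intro n
    obtain ⟨e1, e2, e3⟩ := hφ n
    refine integral_inner_translate_sub_le hO hf hG e1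
      (HasCompactSupport.of_support_subset_isCompact hK.cthickening
        ((subset_tsupport _).trans e3)) e2 (r := ρ) ?_
      ((le_max_left _ _).trans hρ1.le) ((le_max_right _ _).trans hρ1.le)
    intro x hx w hw
    have hx' := e3 hx
    rw [hK.cthickening_eq_biUnion_closedBall (by linarith)] at hx'
    simp only [mem_iUnion, mem_closedBall, exists_prop] at hx'
    obtain ⟨y, hy, hxy⟩ := hx'
    refine hKO (mem_thickening_iff.2 ⟨y, hy, ?_⟩)
    calc dist (x + w) y ≤ dist (x + w) x + dist x y := dist_triangle _ _ _
      _ ≤ ρ + (δ - ρ) / 2 := by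
          gcongr
          simpa [dist_eq_norm] using hw
      _ < δ := by linarith
  have htend : Tendsto (fun n => ∫ x, inner ℝ (g x) (φ n x)) atTop
      (𝓝 (∫ x, inner ℝ (g x) (s x))) := by
    refine tendsto_integral_of_dominated_convergence (fun x => ‖g x‖)
      (fun n => hg.1.inner (hφ n).1.continuous.aestronglyMeasurable) hg.norm
      (fun n => Eventually.of_forall fun x => ?_) ?_
    · exact (norm_inner_le_norm _ _).trans
        (mul_le_of_le_one_right (norm_nonneg _) ((hφ n).2.1 x))
    · filter_upwards [hlim] with x hx
      exact tendsto_const_nhds.inner hx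
  have hfinal := le_of_tendsto' htend hle
  have hval : ∫ x, inner ℝ (g x) (s x) = ∫ x in K, ‖g x‖ := by
    rw [← integral_indicator hK.measurableSet]
    congr with x
    by_cases hx : x ∈ K
    · simp only [s, indicator_of_mem hx, inner_smul_right, real_inner_self_eq_norm_sq]
      rcases eq_or_ne ‖g x‖ 0 with h | h
      · simp [h]
      · field_simp
    · simp [s, hx]
  rw [hval] at hfinal
  have hcongr : eLpNorm (fun x => f (x + a) - f (x + b)) 1 (volume.restrict K) =
      eLpNorm g 1 (volume.restrict K) := by
    refine eLpNorm_congr_ae ?_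
    filter_upwards [ae_restrict_mem hK.measurableSet] with x hx
    exact (hgK x hx).symm
  rw [hcongr, eLpNorm_one_eq_lintegral_enorm, ← ofReal_integral_norm_eq_lintegral_enorm
    hg.restrict]
  calc ENNReal.ofReal (∫ x in K, ‖g x‖)
      ≤ ENNReal.ofReal ((gradientVariation O f).toReal * ‖a - b‖) := ENNReal.ofReal_le_ofReal hfinal
    _ = gradientVariation O f * ‖a - b‖ₑ := by
        rw [ENNReal.ofReal_mul ENNReal.toReal_nonneg, ENNReal.ofReal_toReal hG, ofReal_norm]

end BoundedVariation

/-! ### Increment bounds in space-time for the three classes -/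

section Increments

variable {d : ℕ}

/-- On `K`, the increments `v(· + a) - v(· + b)` in space are `O(|a - b| ^ θ)` in `L^q`, for small
`a` and `b`. -/
def IncrementBound (v : Eucl d × ℝ → Eucl d) (K : Set (Eucl d × ℝ)) (q : ℝ≥0∞) (θ : ℝ) : Prop :=
  ∃ δ : ℝ, 0 < δ ∧ ∃ M : ℝ≥0∞, M ≠ ⊤ ∧ ∀ a b : Eucl d, ‖a‖ < δ → ‖b‖ < δ →
    eLpNorm (fun y => v (y.1 + a, y.2) - v (y.1 + b, y.2)) q (volume.restrict K) ≤
      M * ‖a - b‖ₑ ^ θ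

theorem exists_compactlyContained_thickening {E : Type*} [NormedAddCommGroup E] [ProperSpace E]
    {U K : Set E} (hU : IsOpen U) (hK : IsCompact K) (hKU : K ⊆ U) :
    ∃ δ : ℝ, 0 < δ ∧ CompactlyContained (thickening δ K) U := by
  obtain ⟨δ, hδ, h⟩ := hK.exists_cthickening_subset_open hU hKU
  exact ⟨δ, hδ, isOpen_thickening, hK.cthickening.of_isClosed_subset isClosed_closure
    (closure_thickening_subset_cthickening _ _), (closure_thickening_subset_cthickening _ _).trans h⟩

theorem measurePreserving_space_translate (a : Eucl d) :
    MeasurePreserving fun y : Eucl d × ℝ => (y.1 + a, y.2) :=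
  (measurePreserving_add_right volume a).prod (MeasurePreserving.id volume)

theorem measurableEmbedding_space_translate (a : Eucl d) :
    MeasurableEmbedding fun y : Eucl d × ℝ => (y.1 + a, y.2) := by
  simpa [Prod.add_def] using measurableEmbedding_addRight (a, (0 : ℝ))

theorem ae_ae_eq_of_ae_eq_prod {Ω : Set (Eucl d)} {J : Set ℝ} {u v : Eucl d × ℝ → Eucl d}
    (h : u =ᵐ[volume.restrict (Ω ×ˢ J)] v) :
    ∀ᵐ t ∂volume.restrict J, ∀ᵐ x ∂volume.restrict Ω, u (x, t) = v (x, t) := by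
  rw [Measure.volume_eq_prod, ← Measure.prod_restrict] at h
  have h2 : ∀ᵐ y ∂(volume.restrict J).prod (volume.restrict Ω), u y.swap = v y.swap := by
    have := (Measure.measurePreserving_swap (μ := volume.restrict J)
      (ν := volume.restrict Ω)).quasiMeasurePreserving.ae h
    exact this
  exact Measure.ae_ae_of_ae_prod h2

theorem map_add_right_restrict_le {K S : Set (Eucl d)} {b : Eucl d} (h : ∀ x ∈ K, x + b ∈ S) :
    (volume.restrict K).map (· + b) ≤ volume.restrict S := by
  have := ((measurePreserving_add_right (volume : Measure (Eucl d)) b).restrict_image_emb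
    (measurableEmbedding_addRight b) K).map_eq
  rw [this]
  exact Measure.restrict_mono_set _ (image_subset_iff.2 h)

/-- Translating by `b` turns a two-point increment into the increment of step `a - b` occurring in
the seminorm. The two representatives `f` and `g` agree a.e. also after a translation. -/
theorem eLpNorm_translate_sub_le_besovNorm {O K : Set (Eucl d)} {θ q : ℝ}
    {f g : Eucl d → Eucl d} (hO : MeasurableSet O) (hfg : ∀ᵐ x ∂volume.restrict O, f x = g x)
    (hθ : 0 ≤ θ) {a b : Eucl d} (ha : ∀ x ∈ K, x + a ∈ O) (hb : ∀ x ∈ K, x + b ∈ O) :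
    eLpNorm (fun x => g (x + a) - g (x + b)) (ENNReal.ofReal q) (volume.restrict K) ≤
      besovNorm θ q O f * ‖a - b‖ₑ ^ θ := by
  rcases eq_or_ne a b with rfl | hab
  · simp
  have hne : a - b ≠ 0 := sub_ne_zero.2 hab
  let S : Set (Eucl d) := {x | x ∈ O ∧ x + (a - b) ∈ O}
  have hfg' : ∀ᵐ x, x ∈ O → f x = g x := (ae_restrict_iff' hO).1 hfg
  have hSm : MeasurableSet S := hO.inter ((measurable_add_const (a - b)) hO)
  have e1 : eLpNorm (fun x => g (x + a) - g (x + b)) (ENNReal.ofReal q) (volume.restrict K) ≤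
      eLpNorm (fun x => g (x + (a - b)) - g x) (ENNReal.ofReal q) (volume.restrict S) := by
    refine le_trans (le_of_eq ?_) (eLpNorm_mono_measure _ (map_add_right_restrict_le
      (K := K) (b := b) fun x hx => ⟨hb x hx, by simpa using ha x hx⟩))
    rw [(measurableEmbedding_addRight b).eLpNorm_map_measure]
    congr with x
    simp
  have e2 : eLpNorm (fun x => g (x + (a - b)) - g x) (ENNReal.ofReal q) (volume.restrict S) =
      eLpNorm (fun x => f (x + (a - b)) - f x) (ENNReal.ofReal q) (volume.restrict S) := by
    refine eLpNorm_congr_ae ?_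
    rw [EventuallyEq, ae_restrict_iff' hSm]
    filter_upwards [hfg', (measurePreserving_add_right (volume : Measure (Eucl d))
      (a - b)).quasiMeasurePreserving.ae hfg'] with x h1 h2 hx
    rw [h1 hx.1, h2 hx.2]
  rw [e2] at e1
  refine e1.trans ?_
  have h0 : ‖a - b‖ₑ ≠ 0 := by simpa using hne
  have hp0 : ‖a - b‖ₑ ^ θ ≠ 0 := by simp [h0]
  have hpt : ‖a - b‖ₑ ^ θ ≠ ⊤ := ENNReal.rpow_ne_top_of_nonneg hθ enorm_ne_top
  rw [← ENNReal.div_le_iff hp0 hpt]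
  refine le_trans ?_ le_add_self
  exact le_iSup₂_of_le (a - b) hne le_rfl

/-- Integration in time of an increment bound on the time slices. -/
theorem IncrementBound.of_slices {v : Eucl d × ℝ → Eucl d} (hv : Measurable v)
    {K : Set (Eucl d × ℝ)} {K₁ : Set (Eucl d)} {J : Set ℝ}
    (hK : K ⊆ K₁ ×ˢ J) {θ q : ℝ} (hθ : 0 ≤ θ) (hq : 0 < q)
    {N : ℝ → ℝ≥0∞} (hN : ∫⁻ t in J, N t ^ q < ⊤) {δ : ℝ} (hδ : 0 < δ)
    (h : ∀ᵐ t ∂volume.restrict J, ∀ a b : Eucl d, ‖a‖ < δ → ‖b‖ < δ →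
      eLpNorm (fun x => v (x + a, t) - v (x + b, t)) (ENNReal.ofReal q) (volume.restrict K₁) ≤
        N t * ‖a - b‖ₑ ^ θ) :
    IncrementBound v K (ENNReal.ofReal q) θ := by
  refine ⟨δ, hδ, (∫⁻ t in J, N t ^ q) ^ (1 / q),
    ENNReal.rpow_ne_top_of_nonneg (by positivity) hN.ne, fun a b ha hb => ?_⟩
  have hq0 : ENNReal.ofReal q ≠ 0 := by simpa using hq
  have hw : Measurable fun y : Eucl d × ℝ => v (y.1 + a, y.2) - v (y.1 + b, y.2) := by fun_prop
  refine (eLpNorm_mono_measure _ (Measure.restrict_mono_set _ hK)).trans ?_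
  rw [eLpNorm_eq_lintegral_rpow_enorm_toReal hq0 ENNReal.ofReal_ne_top,
    ENNReal.toReal_ofReal hq.le, Measure.volume_eq_prod, ← Measure.prod_restrict,
    lintegral_prod_symm _ (hw.enorm.pow_const q).aemeasurable]
  calc (∫⁻ t in J, ∫⁻ x in K₁, ‖v (x + a, t) - v (x + b, t)‖ₑ ^ q) ^ (1 / q)
      ≤ (∫⁻ t in J, (‖a - b‖ₑ ^ θ) ^ q * N t ^ q) ^ (1 / q) := by
        gcongr 1
        -- Only monotonicity and multiplication by a finite constant are applied to `N`, so its
        -- measurability is not needed. This matters because slice norms are suprema over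
        -- uncountable families.
        refine lintegral_mono_ae ?_
        filter_upwards [h] with t ht
        have := ENNReal.rpow_le_rpow (ht a b ha hb) hq.le
        rw [eLpNorm_eq_lintegral_rpow_enorm_toReal hq0 ENNReal.ofReal_ne_top,
          ENNReal.toReal_ofReal hq.le, ← ENNReal.rpow_mul, one_div, inv_mul_cancel₀ hq.ne',
          ENNReal.rpow_one, mul_comm, ENNReal.mul_rpow_of_nonneg _ _ hq.le] at this
        exact this
    _ = (∫⁻ t in J, N t ^ q) ^ (1 / q) * ‖a - b‖ₑ ^ θ := by
        rw [lintegral_const_mul' _ _ (ENNReal.rpow_ne_top_of_nonneg hq.le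
          (ENNReal.rpow_ne_top_of_nonneg hθ enorm_ne_top)),
          ENNReal.mul_rpow_of_nonneg _ _ (by positivity), ← ENNReal.rpow_mul, one_div,
          mul_inv_cancel₀ hq.ne', ENNReal.rpow_one, mul_comm]

variable {Ω : Set (Eucl d)} {T : ℝ} {u v : Eucl d × ℝ → Eucl d} {K : Set (Eucl d × ℝ)}

theorem exists_adapted_neighborhoods (hΩ : IsOpen Ω) (hK : IsCompact K)
    (hKQ : K ⊆ Ω ×ˢ Ioo 0 T) : ∃ (K₁ : Set (Eucl d)) (δ : ℝ) (I : Set ℝ), IsCompact K₁ ∧ 0 < δ ∧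
      CompactlyContained (thickening δ K₁) Ω ∧ CompactlyContained I (Ioo 0 T) ∧ K ⊆ K₁ ×ˢ I := by
  have h1 := hK.image continuous_fst
  have h2 := hK.image continuous_snd
  obtain ⟨δ, hδ, hO⟩ := exists_compactlyContained_thickening hΩ h1
    (by rintro _ ⟨y, hy, rfl⟩; exact (hKQ hy).1)
  obtain ⟨δ', hδ', hI⟩ := exists_compactlyContained_thickening (isOpen_Ioo (a := 0) (b := T)) h2
    (by rintro _ ⟨y, hy, rfl⟩; exact (hKQ hy).2)
  exact ⟨_, δ, _, h1, hδ, hO, hI, fun y hy => ⟨mem_image_of_mem _ hy,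
    self_subset_thickening hδ' _ (mem_image_of_mem _ hy)⟩⟩

theorem add_mem_thickening {E : Type*} [NormedAddCommGroup E] {K : Set E} {δ : ℝ} {x a : E}
    (hx : x ∈ K) (ha : ‖a‖ < δ) : x + a ∈ thickening δ K :=
  mem_thickening_iff.2 ⟨x, hx, by simpa [dist_eq_norm] using ha⟩

theorem CompactlyContained.subset {X : Type*} [TopologicalSpace X] {O U : Set X}
    (h : CompactlyContained O U) : O ⊆ U := subset_closure.trans h.2.2

theorem LocLpBesov.incrementBound (hΩ : IsOpen Ω) (hv : Measurable v)
    (huv : u =ᵐ[volume.restrict (Ω ×ˢ Ioo 0 T)] v) {θ q : ℝ} (hθ : 0 ≤ θ) (hq : 0 < q)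
    (h : LocLpBesov Ω T θ q u) (hK : IsCompact K) (hKQ : K ⊆ Ω ×ˢ Ioo 0 T) :
    IncrementBound v K (ENNReal.ofReal q) θ := by
  obtain ⟨K₁, δ, I, -, hδ, hO, hI, hKI⟩ := exists_adapted_neighborhoods hΩ hK hKQ
  refine IncrementBound.of_slices hv hKI hθ hq (h I _ hI hO) hδ ?_
  filter_upwards [ae_restrict_of_ae_restrict_of_subset hI.subset (ae_ae_eq_of_ae_eq_prod huv)]
    with t ht a b ha hb
  exact eLpNorm_translate_sub_le_besovNorm hO.1.measurableSet
    (ae_restrict_of_ae_restrict_of_subset hO.subset ht) hθ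
    (fun x hx => add_mem_thickening hx ha) (fun x hx => add_mem_thickening hx hb)

theorem gradientVariation_congr {O : Set (Eucl d)} {f g : Eucl d → Eucl d}
    (h : ∀ᵐ x ∂volume.restrict O, f x = g x) : gradientVariation O f = gradientVariation O g := by
  have : ∀ Φ : Fin d → Eucl d → Eucl d, ∫ x in O, ∑ i, f x i * divergence (Φ i) x =
      ∫ x in O, ∑ i, g x i * divergence (Φ i) x := fun Φ => by
    refine integral_congr_ae ?_
    filter_upwards [h] with x hx
    rw [hx]
  simp only [gradientVariation, this]

theorem LocL1BV.incrementBound (hΩ : IsOpen Ω) (hv : Measurable v)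
    (huv : u =ᵐ[volume.restrict (Ω ×ˢ Ioo 0 T)] v)
    (h : LocL1BV Ω T u) (hK : IsCompact K) (hKQ : K ⊆ Ω ×ˢ Ioo 0 T) : IncrementBound v K 1 1 := by
  obtain ⟨K₁, δ, I, hK₁, hδ, hO, hI, hKI⟩ := exists_adapted_neighborhoods hΩ hK hKQ
  have key : IncrementBound v K (ENNReal.ofReal 1) 1 := by
    refine IncrementBound.of_slices hv hKI zero_le_one zero_lt_one
      (N := fun t => bvNorm (thickening δ K₁) fun x => u (x, t))
      (by simpa using h I _ hI hO) hδ ?_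
    filter_upwards [ae_restrict_of_ae_restrict_of_subset hI.subset (ae_ae_eq_of_ae_eq_prod huv)]
      with t ht a b ha hb
    have ht' := ae_restrict_of_ae_restrict_of_subset hO.subset ht
    rw [bvNorm, gradientVariation_congr ht', eLpNorm_congr_ae ht', ENNReal.ofReal_one,
      ENNReal.rpow_one]
    -- A slice of infinite `L¹` norm makes the right-hand side infinite unless `a = b`; otherwise
    -- the slice is integrable and the `BV` estimate applies.
    by_cases hfin : eLpNorm (fun x => v (x, t)) 1 (volume.restrict (thickening δ K₁)) = ⊤
    · rcases eq_or_ne a b with rfl | hab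
      · simp
      · rw [hfin, top_add, ENNReal.top_mul (by simpa [sub_eq_zero] using hab)]
        exact le_top
    · have hint : IntegrableOn (fun x => v (x, t)) (thickening δ K₁) :=
        memLp_one_iff_integrable.1 ⟨(hv.comp measurable_prodMk_right).aestronglyMeasurable,
          lt_top_iff_ne_top.2 hfin⟩
      refine (eLpNorm_translate_sub_le_gradientVariation hO.1 hint hK₁ subset_rfl ha hb).trans ?_
      gcongr
      exact le_add_self
  simpa using key

/-- Boundedness enters as a Hölder factor with exponent `∞` that carries no power of the increment.
-/
theorem LocLinfty.incrementBound (hΩ : IsOpen Ω) (hv : Measurable v)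
    (huv : u =ᵐ[volume.restrict (Ω ×ˢ Ioo 0 T)] v)
    (h : LocLinfty Ω T u) (hK : IsCompact K) (hKQ : K ⊆ Ω ×ˢ Ioo 0 T) : IncrementBound v K ⊤ 0 := by
  obtain ⟨K₁, δ, I, hK₁, hδ, hO, hI, hKI⟩ := exists_adapted_neighborhoods hΩ hK hKQ
  have hfin := h I _ hI hO
  set M := eLpNorm u ⊤ (volume.restrict (thickening δ K₁ ×ˢ I)) with hM
  have hMv : eLpNorm v ⊤ (volume.restrict (thickening δ K₁ ×ˢ I)) = M :=
    (eLpNorm_congr_ae (ae_restrict_of_ae_restrict_of_subset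
      (prod_mono hO.subset hI.subset) huv)).symm
  have hone : ∀ a : Eucl d, ‖a‖ < δ →
      eLpNorm (fun y => v (y.1 + a, y.2)) ⊤ (volume.restrict K) ≤ M := fun a ha => by
    have hmap := ((measurePreserving_space_translate a).restrict_image_emb
      (measurableEmbedding_space_translate a) K).map_eq
    have e1 : eLpNorm (fun y => v (y.1 + a, y.2)) ⊤ (volume.restrict K) =
        eLpNorm v ⊤ (volume.restrict ((fun y : Eucl d × ℝ => (y.1 + a, y.2)) '' K)) := by
      rw [← hmap, (measurableEmbedding_space_translate a).eLpNorm_map_measure]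
      rfl
    rw [e1, ← hMv]
    refine eLpNorm_mono_measure _ (Measure.restrict_mono_set _ ?_)
    rintro _ ⟨y, hy, rfl⟩
    exact ⟨add_mem_thickening (hKI hy).1 ha, (hKI hy).2⟩
  refine ⟨δ, hδ, M + M, ENNReal.add_ne_top.2 ⟨hfin.ne, hfin.ne⟩, fun a b ha hb => ?_⟩
  have hm : ∀ a : Eucl d, AEStronglyMeasurable (fun y : Eucl d × ℝ => v (y.1 + a, y.2))
      (volume.restrict K) := fun a => by
    have : Measurable fun y : Eucl d × ℝ => v (y.1 + a, y.2) := by fun_prop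
    exact this.aestronglyMeasurable
  rw [ENNReal.rpow_zero, mul_one]
  exact (eLpNorm_sub_le (hm a) (hm b) le_top).trans (add_le_add (hone a ha) (hone b hb))

end Increments

/-! ### The uniform Hölder estimate for the cubic increments -/

section CubicIncrements

variable {d : ℕ}

/-- `ε⁻¹ |δ_{εz} v|² δ_{εz} v`. -/
def cubicIncrement (v : Eucl d × ℝ → Eucl d) (ε : ℝ) (z : Eucl d) (y : Eucl d × ℝ) : Eucl d :=
  (ε⁻¹ * ‖increment v (ε • z) y‖ ^ 2) • increment v (ε • z) y

/-- On `K`, the map `z ↦ ε⁻¹ |δ_{εz} v|² δ_{εz} v` satisfies a Hölder estimate in `L¹`, uniformly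
in small `ε`. -/
def CubicHolder (v : Eucl d × ℝ → Eucl d) (K : Set (Eucl d × ℝ)) (α β : ℝ) : Prop :=
  ∃ C : ℝ, 0 < C ∧ ∃ δ : ℝ, 0 < δ ∧ ∀ ε, 0 < ε → ε < δ → ∀ z₁ ∈ closedBall (0 : Eucl d) 1,
    ∀ z₂ ∈ closedBall (0 : Eucl d) 1,
      ∫⁻ y in K, ‖cubicIncrement v ε z₁ y - cubicIncrement v ε z₂ y‖ₑ ≤
        ENNReal.ofReal (C * ‖z₁ - z₂‖ ^ α * (‖z₁‖ ^ β + ‖z₂‖ ^ β))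

theorem measurable_increment {v : Eucl d × ℝ → Eucl d} (hv : Measurable v) (ξ : Eucl d) :
    Measurable (increment v ξ) := by
  unfold increment
  fun_prop

theorem measurable_cubicIncrement {v : Eucl d × ℝ → Eucl d} (hv : Measurable v) (ε : ℝ)
    (z : Eucl d) : Measurable (cubicIncrement v ε z) := by
  have := measurable_increment hv (ε • z)
  unfold cubicIncrement
  fun_prop

/-- The mixed term `‖a‖ ‖b‖` is absorbed into the squares, so each remaining product involves the
difference and only one of the two increments. This is the source of the sum `‖z₁‖ ^ β + ‖z₂‖ ^ β`.
-/
theorem norm_sq_smul_sub_le {E : Type*} [NormedAddCommGroup E] [NormedSpace ℝ E] (a b : E) :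
    ‖‖a‖ ^ 2 • a - ‖b‖ ^ 2 • b‖ ≤ 2 * (‖a - b‖ * (‖a‖ * ‖a‖) + ‖a - b‖ * (‖b‖ * ‖b‖)) := by
  have h : ‖a‖ ^ 2 • a - ‖b‖ ^ 2 • b = ‖a‖ ^ 2 • (a - b) + (‖a‖ ^ 2 - ‖b‖ ^ 2) • b := by
    module
  have h1 : |‖a‖ ^ 2 - ‖b‖ ^ 2| ≤ ‖a - b‖ * (‖a‖ + ‖b‖) := by
    rw [sq_sub_sq, abs_mul, abs_of_nonneg (by positivity), mul_comm]
    gcongr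
    exact abs_norm_sub_norm_le a b
  calc ‖‖a‖ ^ 2 • a - ‖b‖ ^ 2 • b‖ ≤ ‖a‖ ^ 2 * ‖a - b‖ + ‖a - b‖ * (‖a‖ + ‖b‖) * ‖b‖ := by
        rw [h]
        refine (norm_add_le _ _).trans ?_
        rw [norm_smul, norm_smul, Real.norm_of_nonneg (by positivity), Real.norm_eq_abs]
        gcongr
    _ ≤ 2 * (‖a - b‖ * (‖a‖ * ‖a‖) + ‖a - b‖ * (‖b‖ * ‖b‖)) := by
        nlinarith [mul_nonneg (norm_nonneg (a - b)) (sq_nonneg (‖a‖ - ‖b‖)),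
          mul_nonneg (norm_nonneg (a - b)) (sq_nonneg ‖a‖),
          mul_nonneg (norm_nonneg (a - b)) (sq_nonneg ‖b‖)]

theorem lintegral_mul_mul_le_eLpNorm {α E : Type*} [MeasurableSpace α] [NormedAddCommGroup E]
    {m : Measure α} {f g h : α → E} (hf : AEStronglyMeasurable f m) (hg : AEStronglyMeasurable g m)
    (hh : AEStronglyMeasurable h m) {p q r : ℝ≥0∞} (hpqr : p⁻¹ + (q⁻¹ + r⁻¹) = 1) :
    ∫⁻ x, ‖f x‖ₑ * (‖g x‖ₑ * ‖h x‖ₑ) ∂m ≤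
      eLpNorm f p m * (eLpNorm g q m * eLpNorm h r m) := by
  have i1 : ENNReal.HolderTriple q r (q⁻¹ + r⁻¹)⁻¹ := ⟨by rw [inv_inv]⟩
  have i2 : ENNReal.HolderTriple p (q⁻¹ + r⁻¹)⁻¹ 1 := ⟨by rw [inv_inv, hpqr, inv_one]⟩
  have e1 := eLpNorm_smul_le_mul_eLpNorm hh.norm hg.norm (p := q) (q := r) (r := (q⁻¹ + r⁻¹)⁻¹)
  have e2 := eLpNorm_smul_le_mul_eLpNorm (hg.norm.smul hh.norm) hf.norm (p := p)
    (q := (q⁻¹ + r⁻¹)⁻¹) (r := 1)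
  rw [eLpNorm_one_eq_lintegral_enorm] at e2
  simp only [Pi.smul_apply', smul_eq_mul, Pi.mul_apply, enorm_mul, enorm_norm,
    eLpNorm_norm] at e1 e2
  exact e2.trans (mul_le_mul' le_rfl e1)

theorem enorm_rpow_eq_ofReal {E : Type*} [SeminormedAddCommGroup E] (x : E) {θ : ℝ} (hθ : 0 ≤ θ) :
    ‖x‖ₑ ^ θ = ENNReal.ofReal (‖x‖ ^ θ) := by
  rw [← ofReal_norm, ENNReal.ofReal_rpow_of_nonneg (norm_nonneg _) hθ]

/-- The difference of increments is measured in `L^p`, the two other factors in `L^q` and `L^r`. The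
powers of `ε` multiply to `ε ^ (θ₁ + θ₂ + θ₃) = ε`, cancelling the prefactor `ε⁻¹`. -/
theorem CubicHolder.of_incrementBound {v : Eucl d × ℝ → Eucl d} (hv : Measurable v)
    {K : Set (Eucl d × ℝ)} {p q r : ℝ≥0∞} (hpqr : p⁻¹ + (q⁻¹ + r⁻¹) = 1) {θ₁ θ₂ θ₃ : ℝ}
    (h₁ : 0 ≤ θ₁) (h₂ : 0 ≤ θ₂) (h₃ : 0 ≤ θ₃) (hθ : θ₁ + (θ₂ + θ₃) = 1)
    (H₁ : IncrementBound v K p θ₁) (H₂ : IncrementBound v K q θ₂) (H₃ : IncrementBound v K r θ₃) :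
    CubicHolder v K θ₁ (θ₂ + θ₃) := by
  obtain ⟨δ₁, hδ₁, M₁, hM₁, H₁⟩ := H₁
  obtain ⟨δ₂, hδ₂, M₂, hM₂, H₂⟩ := H₂
  obtain ⟨δ₃, hδ₃, M₃, hM₃, H₃⟩ := H₃
  lift M₁ to NNReal using hM₁
  lift M₂ to NNReal using hM₂
  lift M₃ to NNReal using hM₃
  -- The factor `2` comes from `norm_sq_smul_sub_le`; the `+ 1` keeps the constant positive when
  -- some `Mᵢ` vanishes.
  refine ⟨2 * (M₁ * (M₂ * M₃)) + 1, by positivity, min δ₁ (min δ₂ δ₃), by positivity, ?_⟩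
  intro ε hε hεδ z₁ hz₁ z₂ hz₂
  have hm : ∀ z, AEStronglyMeasurable (increment v (ε • z)) (volume.restrict K) := fun z =>
    (measurable_increment hv _).aestronglyMeasurable
  have hsmall : ∀ z ∈ closedBall (0 : Eucl d) 1, ‖ε • z‖ < min δ₁ (min δ₂ δ₃) := fun z hz => by
    rw [norm_smul, Real.norm_of_nonneg hε.le]
    exact (mul_le_of_le_one_right hε.le (by simpa using hz)).trans_lt hεδ
  have hs₁ := fun z hz => (hsmall z hz).trans_le (min_le_left _ _)
  have hs₂ := fun z hz => (hsmall z hz).trans_le ((min_le_right _ _).trans (min_le_left _ _))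
  have hs₃ := fun z hz => (hsmall z hz).trans_le ((min_le_right _ _).trans (min_le_right _ _))
  have hrw : ∀ (z : Eucl d) {θ : ℝ}, 0 ≤ θ → ‖ε • z‖ₑ ^ θ = ENNReal.ofReal (ε ^ θ * ‖z‖ ^ θ) :=
    fun z θ h => by
      rw [enorm_rpow_eq_ofReal _ h, norm_smul, Real.norm_of_nonneg hε.le,
        Real.mul_rpow hε.le (norm_nonneg _)]
  have b₁ : eLpNorm (increment v (ε • z₁) - increment v (ε • z₂)) p (volume.restrict K) ≤
      M₁ * ENNReal.ofReal (ε ^ θ₁ * ‖z₁ - z₂‖ ^ θ₁) := by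
    rw [← hrw _ h₁, smul_sub]
    refine le_trans (le_of_eq ?_) (H₁ _ _ (hs₁ z₁ hz₁) (hs₁ z₂ hz₂))
    congr 1
    funext y
    simp [increment]
  have hzero : ∀ z, increment v (ε • z) = fun y => v (y.1 + ε • z, y.2) - v (y.1 + 0, y.2) :=
    fun z => by
      funext y
      simp [increment]
  have b₂ : ∀ z ∈ closedBall (0 : Eucl d) 1, eLpNorm (increment v (ε • z)) q (volume.restrict K) ≤
      M₂ * ENNReal.ofReal (ε ^ θ₂ * ‖z‖ ^ θ₂) := fun z hz => by
    rw [← hrw _ h₂, hzero]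
    simpa using H₂ (ε • z) 0 (hs₂ z hz) (by simpa using hδ₂)
  have b₃ : ∀ z ∈ closedBall (0 : Eucl d) 1, eLpNorm (increment v (ε • z)) r (volume.restrict K) ≤
      M₃ * ENNReal.ofReal (ε ^ θ₃ * ‖z‖ ^ θ₃) := fun z hz => by
    rw [← hrw _ h₃, hzero]
    simpa using H₃ (ε • z) 0 (hs₃ z hz) (by simpa using hδ₃)
  have hpow : ε⁻¹ * (ε ^ θ₁ * (ε ^ θ₂ * ε ^ θ₃)) = 1 := by
    rw [← Real.rpow_add hε, ← Real.rpow_add hε, hθ, Real.rpow_one, inv_mul_cancel₀ hε.ne']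
  have hterm : ∀ z ∈ closedBall (0 : Eucl d) 1,
      ∫⁻ y in K, ‖(increment v (ε • z₁) - increment v (ε • z₂)) y‖ₑ *
        (‖increment v (ε • z) y‖ₑ * ‖increment v (ε • z) y‖ₑ) ≤
      ENNReal.ofReal (ε * (M₁ * (M₂ * M₃) * ‖z₁ - z₂‖ ^ θ₁ * ‖z‖ ^ (θ₂ + θ₃))) := fun z hz => by
    refine (lintegral_mul_mul_le_eLpNorm ((hm z₁).sub (hm z₂)) (hm z) (hm z) hpqr).trans ?_
    refine (mul_le_mul' b₁ (mul_le_mul' (b₂ z hz) (b₃ z hz))).trans (le_of_eq ?_)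
    rw [← ENNReal.ofReal_coe_nnreal, ← ENNReal.ofReal_coe_nnreal, ← ENNReal.ofReal_coe_nnreal,
      ← ENNReal.ofReal_mul (by positivity), ← ENNReal.ofReal_mul (by positivity),
      ← ENNReal.ofReal_mul (by positivity), ← ENNReal.ofReal_mul (by positivity),
      ← ENNReal.ofReal_mul (by positivity), Real.rpow_add_of_nonneg (norm_nonneg _) h₂ h₃]
    congr 1
    have hpow' : ε ^ θ₁ * (ε ^ θ₂ * ε ^ θ₃) = ε := by
      rw [← Real.rpow_add hε, ← Real.rpow_add hε, hθ, Real.rpow_one]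
    linear_combination (M₁ * (M₂ * M₃) * ‖z₁ - z₂‖ ^ θ₁ * (‖z‖ ^ θ₂ * ‖z‖ ^ θ₃)) * hpow'
  have hpt : ∀ y, ‖cubicIncrement v ε z₁ y - cubicIncrement v ε z₂ y‖ₑ ≤
      ENNReal.ofReal (ε⁻¹ * 2) *
        (‖(increment v (ε • z₁) - increment v (ε • z₂)) y‖ₑ *
          (‖increment v (ε • z₁) y‖ₑ * ‖increment v (ε • z₁) y‖ₑ) +
        ‖(increment v (ε • z₁) - increment v (ε • z₂)) y‖ₑ *
          (‖increment v (ε • z₂) y‖ₑ * ‖increment v (ε • z₂) y‖ₑ)) := fun y => by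
    have h := norm_sq_smul_sub_le (increment v (ε • z₁) y) (increment v (ε • z₂) y)
    have h' : ‖cubicIncrement v ε z₁ y - cubicIncrement v ε z₂ y‖ ≤ ε⁻¹ * 2 *
        (‖(increment v (ε • z₁) - increment v (ε • z₂)) y‖ *
          (‖increment v (ε • z₁) y‖ * ‖increment v (ε • z₁) y‖) +
        ‖(increment v (ε • z₁) - increment v (ε • z₂)) y‖ *
          (‖increment v (ε • z₂) y‖ * ‖increment v (ε • z₂) y‖)) := by
      simp only [cubicIncrement, mul_smul, ← smul_sub, Pi.sub_apply]
      rw [norm_smul, Real.norm_of_nonneg (by positivity), mul_assoc]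
      gcongr
    rw [← ofReal_norm]
    refine (ENNReal.ofReal_le_ofReal h').trans (le_of_eq ?_)
    rw [ENNReal.ofReal_mul (by positivity), ENNReal.ofReal_add (by positivity) (by positivity)]
    simp only [ENNReal.ofReal_mul (norm_nonneg _), ofReal_norm]
  have hmeas : AEMeasurable (fun y => ‖(increment v (ε • z₁) - increment v (ε • z₂)) y‖ₑ *
      (‖increment v (ε • z₁) y‖ₑ * ‖increment v (ε • z₁) y‖ₑ)) (volume.restrict K) :=
    ((hm z₁).sub (hm z₂)).enorm.mul ((hm z₁).enorm.mul (hm z₁).enorm)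
  calc ∫⁻ y in K, ‖cubicIncrement v ε z₁ y - cubicIncrement v ε z₂ y‖ₑ
      ≤ ENNReal.ofReal (ε⁻¹ * 2) *
        (ENNReal.ofReal (ε * (M₁ * (M₂ * M₃) * ‖z₁ - z₂‖ ^ θ₁ * ‖z₁‖ ^ (θ₂ + θ₃))) +
        ENNReal.ofReal (ε * (M₁ * (M₂ * M₃) * ‖z₁ - z₂‖ ^ θ₁ * ‖z₂‖ ^ (θ₂ + θ₃)))) := by
        refine (lintegral_mono hpt).trans ?_
        rw [lintegral_const_mul' _ _ ENNReal.ofReal_ne_top, lintegral_add_left' hmeas]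
        gcongr
        · exact hterm z₁ hz₁
        · exact hterm z₂ hz₂
    _ = ENNReal.ofReal (2 * (M₁ * (M₂ * M₃)) * ‖z₁ - z₂‖ ^ θ₁ *
          (‖z₁‖ ^ (θ₂ + θ₃) + ‖z₂‖ ^ (θ₂ + θ₃))) := by
        rw [← ENNReal.ofReal_add (by positivity) (by positivity),
          ← ENNReal.ofReal_mul (by positivity)]
        congr 1
        field_simp
    _ ≤ _ := by
        refine ENNReal.ofReal_le_ofReal ?_
        gcongr
        linarith

variable {Ω : Set (Eucl d)} {T : ℝ} {u v : Eucl d × ℝ → Eucl d} {K : Set (Eucl d × ℝ)}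

/-- One factor is taken in `L^p` and two in `L^{2p'}`; the difference is placed where the regularity
is larger. Since `1/p ≥ 1/(2p')` exactly when `p ≤ 3`, it goes into `L^p` for `p ≤ 3` and into
`L^{2p'}` for `p ≥ 3`. The two remaining exponents add up to `1/p'` and `(p+1)/(2p)` respectively.
-/
theorem BesovClass.cubicHolder (hΩ : IsOpen Ω) (hv : Measurable v)
    (huv : u =ᵐ[volume.restrict (Ω ×ˢ Ioo 0 T)] v) {p : ℝ} (hp : 1 < p) (h : BesovClass Ω T p u)
    (hK : IsCompact K) (hKQ : K ⊆ Ω ×ˢ Ioo 0 T) :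
    CubicHolder v K (max (1 / p) (1 / (2 * conjExp p)))
      (min (1 / conjExp p) ((p + 1) / (2 * p))) := by
  have hp0 : 0 < p := by linarith
  have hp1 : 0 < p - 1 := by linarith
  have hc : 0 < conjExp p := div_pos hp0 hp1
  have hci : 1 / (2 * conjExp p) = (p - 1) / (2 * p) := by
    rw [conjExp]; field_simp
  have hci' : 1 / conjExp p = (p - 1) / p := by
    rw [conjExp]; field_simp
  have hQ : (ENNReal.ofReal (2 * conjExp p))⁻¹ = ENNReal.ofReal (1 / (2 * conjExp p)) := by
    rw [← ENNReal.ofReal_inv_of_pos (by positivity), one_div]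
  have hP : (ENNReal.ofReal p)⁻¹ = ENNReal.ofReal (1 / p) := by
    rw [← ENNReal.ofReal_inv_of_pos hp0, one_div]
  have B₁ := h.1.incrementBound hΩ hv huv (by positivity) hp0 hK hKQ
  have B₂ := h.2.incrementBound hΩ hv huv (by positivity) (by positivity) hK hKQ
  have hsum : 1 / p + (1 / (2 * conjExp p) + 1 / (2 * conjExp p)) = 1 := by
    rw [hci]; field_simp; ring
  rcases le_total p 3 with h3 | h3
  · have e1 : max (1 / p) (1 / (2 * conjExp p)) = 1 / p := by
      refine max_eq_left ?_
      rw [hci, div_le_div_iff₀ (by positivity) hp0]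
      nlinarith
    have e2 : min (1 / conjExp p) ((p + 1) / (2 * p)) =
        1 / (2 * conjExp p) + 1 / (2 * conjExp p) := by
      rw [min_eq_left]
      · field_simp; norm_num
      · rw [hci', div_le_div_iff₀ hp0 (by positivity)]
        nlinarith
    rw [e1, e2]
    refine CubicHolder.of_incrementBound hv ?_ (by positivity) (by positivity) (by positivity)
      hsum B₁ B₂ B₂
    rw [hP, hQ, ← ENNReal.ofReal_add (by positivity) (by positivity),
      ← ENNReal.ofReal_add (by positivity) (by positivity), hsum, ENNReal.ofReal_one]
  · have e1 : max (1 / p) (1 / (2 * conjExp p)) = 1 / (2 * conjExp p) := by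
      refine max_eq_right ?_
      rw [hci, div_le_div_iff₀ hp0 (by positivity)]
      nlinarith
    have e2 : min (1 / conjExp p) ((p + 1) / (2 * p)) = 1 / (2 * conjExp p) + 1 / p := by
      rw [min_eq_right]
      · rw [hci]; field_simp; ring
      · rw [hci', div_le_div_iff₀ (by positivity) hp0]
        nlinarith
    have hsum' : 1 / (2 * conjExp p) + (1 / (2 * conjExp p) + 1 / p) = 1 := by linarith
    rw [e1, e2]
    refine CubicHolder.of_incrementBound hv ?_ (by positivity) (by positivity) (by positivity)
      hsum' B₂ B₂ B₁
    rw [hP, hQ, ← ENNReal.ofReal_add (by positivity) (by positivity),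
      ← ENNReal.ofReal_add (by positivity) (by positivity), hsum', ENNReal.ofReal_one]

/-- Integrability exponents `2, 2, ∞` with regularities `1/2, 1/2, 0`. -/
theorem HalfClass.cubicHolder (hΩ : IsOpen Ω) (hv : Measurable v)
    (huv : u =ᵐ[volume.restrict (Ω ×ˢ Ioo 0 T)] v) (h : HalfClass Ω T u)
    (hK : IsCompact K) (hKQ : K ⊆ Ω ×ˢ Ioo 0 T) : CubicHolder v K (1 / 2) (1 / 2) := by
  have B₁ := h.1.incrementBound hΩ hv huv (by positivity) (by positivity) hK hKQ
  have B₂ := h.2.incrementBound hΩ hv huv hK hKQ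
  have hpqr : (ENNReal.ofReal 2)⁻¹ + ((ENNReal.ofReal 2)⁻¹ + (⊤ : ℝ≥0∞)⁻¹) = 1 := by
    simpa using ENNReal.inv_two_add_inv_two
  simpa using CubicHolder.of_incrementBound hv hpqr (by norm_num) (by norm_num) le_rfl
    (by norm_num) B₁ B₁ B₂

/-- Integrability exponents `1, ∞, ∞` with regularities `1, 0, 0`. -/
theorem BVClass.cubicHolder (hΩ : IsOpen Ω) (hv : Measurable v)
    (huv : u =ᵐ[volume.restrict (Ω ×ˢ Ioo 0 T)] v) (h : BVClass Ω T u)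
    (hK : IsCompact K) (hKQ : K ⊆ Ω ×ˢ Ioo 0 T) : CubicHolder v K 1 0 := by
  have B₁ := h.1.incrementBound hΩ hv huv hK hKQ
  have B₂ := h.2.incrementBound hΩ hv huv hK hKQ
  simpa using CubicHolder.of_incrementBound hv (by simp) (by norm_num) le_rfl le_rfl
    (by norm_num) B₁ B₂ B₂

end CubicIncrements

/-! ### Properties of the kernels -/

section Kernels

variable {d : ℕ} {ρ : Eucl d → ℝ}

theorem IsKernel.continuous_gradient (hρ : IsKernel ρ) : Continuous (gradient ρ) :=
  (InnerProductSpace.toDual ℝ (Eucl d)).symm.continuous.comp (hρ.1.continuous_fderiv (by simp))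

theorem IsKernel.gradient_eq_zero (hρ : IsKernel ρ) {z : Eucl d} (hz : z ∉ ball (0 : Eucl d) 1) :
    gradient ρ z = 0 := by
  have h : fderiv ℝ ρ z = 0 := by
    by_contra h
    exact hz (hρ.2.1 (support_fderiv_subset ℝ h))
  simp [gradient, h]

theorem IsKernel.exists_norm_gradient_le (hρ : IsKernel ρ) :
    ∃ G, 0 ≤ G ∧ ∀ z, ‖gradient ρ z‖ ≤ G := by
  have hc : HasCompactSupport (gradient ρ) :=
    HasCompactSupport.intro (isCompact_closedBall (0 : Eucl d) 1) fun z hz =>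
      hρ.gradient_eq_zero fun h => hz (ball_subset_closedBall h)
  obtain ⟨G, hG⟩ := hc.exists_bound_of_continuous hρ.continuous_gradient
  exact ⟨G, (norm_nonneg _).trans (hG 0), hG⟩

theorem IsKernel.gradient_neg (hρ : IsKernel ρ) (z : Eucl d) : gradient ρ (-z) = -gradient ρ z := by
  have h : fderiv ℝ ρ z = -fderiv ℝ ρ (-z) := by
    conv_lhs => rw [show ρ = fun x => ρ (-x) from funext fun x => (hρ.2.2.2.2 x).symm]
    exact ((ContinuousLinearEquiv.neg ℝ : Eucl d ≃L[ℝ] Eucl d).comp_right_fderiv (f := ρ)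
      (x := z)).trans (by ext w; simp)
  simp [gradient, h]

theorem exists_isKernel (d : ℕ) : ∃ ρ : Eucl d → ℝ, IsKernel ρ := by
  let β : ContDiffBump (0 : Eucl d) := ⟨1 / 4, 1 / 2, by norm_num, by norm_num⟩
  refine ⟨β.normed volume, β.contDiff_normed, ?_, β.integral_normed, β.nonneg_normed, fun z => ?_⟩
  · rw [β.tsupport_normed_eq]
    exact closedBall_subset_ball (by norm_num)
  · exact β.normed_neg z

/-- The substitution `z ↦ -z` preserves the ball, and `∇ρ` is odd because `ρ` is even; nothing about
`μ` enters. -/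
theorem IsKernel.kernelIntegral_comp_neg {U : Set (Eucl d × ℝ)} (hρ : IsKernel ρ)
    (μ : Eucl d → RadonVectorMeasure U (Eucl d)) (φ : Eucl d × ℝ → ℝ) :
    kernelIntegral ρ (fun z => μ (-z)) φ = -kernelIntegral ρ μ φ := by
  simp only [kernelIntegral]
  have h := (Measure.measurePreserving_neg (volume : Measure (Eucl d))).setIntegral_preimage_emb
    (MeasurableEquiv.neg (Eucl d)).measurableEmbedding
    (fun z => inner ℝ (gradient ρ (-z)) ((μ z).pairing φ)) (ball 0 1)
  simp only [neg_neg, neg_preimage, neg_ball, neg_zero] at h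
  rw [h, ← integral_neg]
  simp only [hρ.gradient_neg, inner_neg_left]

end Kernels

/-! ### The Duchon–Robert approximations as averages of cubic increments -/

section DuchonRobert

variable {d : ℕ} {ρ : Eucl d → ℝ} {v : Eucl d × ℝ → Eucl d} {ε : ℝ}

theorem IsKernel.duchonRobert_eq (hρ : IsKernel ρ) (v : Eucl d × ℝ → Eucl d) (ε : ℝ)
    (y : Eucl d × ℝ) : duchonRobert ρ v ε y =
      1 / 4 * ∫ z in ball (0 : Eucl d) 1, inner ℝ (gradient ρ z) (cubicIncrement v ε z y) := by
  rw [duchonRobert, setIntegral_eq_integral_of_forall_compl_eq_zero, ← integral_const_mul,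
    ← integral_const_mul]
  · congr with z
    rw [cubicIncrement, inner_smul_right]
    rw [one_div, mul_inv]
    ring
  · intro z hz
    rw [hρ.gradient_eq_zero hz, inner_zero_left]

theorem measurable_cubicIncrement_uncurry (hv : Measurable v) (ε : ℝ) :
    Measurable fun p : Eucl d × Eucl d × ℝ => cubicIncrement v ε p.1 p.2 := by
  unfold cubicIncrement increment
  fun_prop

theorem IsKernel.measurable_inner_cubicIncrement (hρ : IsKernel ρ) (hv : Measurable v) (ε : ℝ) :
    Measurable fun p : Eucl d × Eucl d × ℝ =>
      inner ℝ (gradient ρ p.1) (cubicIncrement v ε p.1 p.2) :=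
  (hρ.continuous_gradient.measurable.comp measurable_fst).inner
    (measurable_cubicIncrement_uncurry hv ε)

theorem IsKernel.stronglyMeasurable_duchonRobert (hρ : IsKernel ρ) (hv : Measurable v) (ε : ℝ) :
    StronglyMeasurable (duchonRobert ρ v ε) := by
  rw [show duchonRobert ρ v ε = fun y => _ from funext (hρ.duchonRobert_eq v ε)]
  exact (((hρ.measurable_inner_cubicIncrement hv ε).comp
    measurable_swap).stronglyMeasurable.integral_prod_right').const_mul _

/-- This supplies the local `L¹` bound by which weak limits of the approximations are Radon
measures. -/
theorem IsKernel.lintegral_duchonRobert_le (hρ : IsKernel ρ) (hv : Measurable v) {G : ℝ}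
    (hG : ∀ z, ‖gradient ρ z‖ ≤ G) {K : Set (Eucl d × ℝ)} {C : ℝ≥0∞}
    (hC : ∀ z ∈ ball (0 : Eucl d) 1, ∫⁻ y in K, ‖cubicIncrement v ε z y‖ₑ ≤ C) :
    ∫⁻ y in K, ‖duchonRobert ρ v ε y‖ₑ ≤
      ENNReal.ofReal G * C * volume (ball (0 : Eucl d) 1) := by
  have hG' : ∀ z w, ‖(inner ℝ (gradient ρ z) w : ℝ)‖ₑ ≤ ENNReal.ofReal G * ‖w‖ₑ := fun z w => by
    rw [← ofReal_norm, ← ofReal_norm, ← ENNReal.ofReal_mul ((norm_nonneg _).trans (hG z))]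
    refine ENNReal.ofReal_le_ofReal ((norm_inner_le_norm _ _).trans ?_)
    gcongr
    exact hG z
  have hm := (measurable_cubicIncrement_uncurry hv ε).enorm
  calc ∫⁻ y in K, ‖duchonRobert ρ v ε y‖ₑ
      ≤ ∫⁻ y in K, ∫⁻ z in ball (0 : Eucl d) 1, ENNReal.ofReal G * ‖cubicIncrement v ε z y‖ₑ := by
        refine lintegral_mono fun y => ?_
        rw [hρ.duchonRobert_eq, enorm_mul]
        refine (mul_le_of_le_one_left bot_le ?_).trans ?_
        · rw [← ofReal_norm]
          refine ENNReal.ofReal_le_one.2 ?_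
          norm_num
        · exact (enorm_integral_le_lintegral_enorm _).trans (lintegral_mono fun z => hG' _ _)
    _ = ∫⁻ z in ball (0 : Eucl d) 1, ∫⁻ y in K, ENNReal.ofReal G * ‖cubicIncrement v ε z y‖ₑ := by
        rw [lintegral_lintegral_swap]
        exact ((hm.comp measurable_swap).const_mul _).aemeasurable
    _ ≤ ∫⁻ _ in ball (0 : Eucl d) 1, ENNReal.ofReal G * C := by
        refine setLIntegral_mono' measurableSet_ball fun z hz => ?_
        rw [lintegral_const_mul' _ _ ENNReal.ofReal_ne_top]
        gcongr
        exact hC z hz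
    _ = _ := by rw [setLIntegral_const]

theorem IsKernel.integral_mul_duchonRobert (hρ : IsKernel ρ) (hv : Measurable v)
    {U : Set (Eucl d × ℝ)} {φ : Eucl d × ℝ → ℝ} (hφ : IsTestFunction U φ) {C : ℝ≥0∞} (hCt : C ≠ ⊤)
    (hC : ∀ z ∈ ball (0 : Eucl d) 1, ∫⁻ y in tsupport φ, ‖cubicIncrement v ε z y‖ₑ ≤ C) :
    ∫ y, φ y * duchonRobert ρ v ε y = 1 / 4 * ∫ z in ball (0 : Eucl d) 1,
      inner ℝ (gradient ρ z) (∫ y, φ y • cubicIncrement v ε z y) := by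
  obtain ⟨G, hG0, hG⟩ := hρ.exists_norm_gradient_le
  obtain ⟨B, hB0, hB⟩ := hφ.exists_bound
  have hφm : Measurable φ := hφ.1.measurable
  let w : Eucl d × Eucl d × ℝ → ℝ := fun p =>
    φ p.2 * inner ℝ (gradient ρ p.1) (cubicIncrement v ε p.1 p.2)
  have hw : Measurable w :=
    (hφm.comp measurable_snd).mul (hρ.measurable_inner_cubicIncrement hv ε)
  have hint : Integrable w ((volume.restrict (ball (0 : Eucl d) 1)).prod volume) := by
    refine ⟨hw.aestronglyMeasurable, ?_⟩
    rw [HasFiniteIntegral, lintegral_prod _ hw.enorm.aemeasurable]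
    have hle : ∀ p, ‖w p‖ₑ ≤ ENNReal.ofReal (B * G) *
        (tsupport φ).indicator (fun y => ‖cubicIncrement v ε p.1 y‖ₑ) p.2 := fun p => by
      by_cases hp : p.2 ∈ tsupport φ
      · rw [indicator_of_mem hp, ← ofReal_norm, ← ofReal_norm, ← ENNReal.ofReal_mul (by positivity)]
        refine ENNReal.ofReal_le_ofReal ?_
        simp only [w, norm_mul, mul_assoc]
        gcongr
        · exact hB _
        · refine (norm_inner_le_norm _ _).trans ?_
          gcongr
          exact hG _
      · simp [w, image_eq_zero_of_notMem_tsupport hp]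
    calc ∫⁻ z in ball (0 : Eucl d) 1, ∫⁻ y, ‖w (z, y)‖ₑ
        ≤ ∫⁻ z in ball (0 : Eucl d) 1, ENNReal.ofReal (B * G) * C := by
          refine setLIntegral_mono' measurableSet_ball fun z hz => ?_
          refine (lintegral_mono fun y => hle (z, y)).trans ?_
          simp only
          rw [lintegral_const_mul' _ _ ENNReal.ofReal_ne_top,
            lintegral_indicator (isClosed_tsupport φ).measurableSet]
          gcongr
          exact hC z hz
      _ < ⊤ := by
          rw [setLIntegral_const]
          exact ENNReal.mul_lt_top (ENNReal.mul_lt_top ENNReal.ofReal_lt_top hCt.lt_top)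
            measure_ball_lt_top
  calc ∫ y, φ y * duchonRobert ρ v ε y
      = 1 / 4 * ∫ y, ∫ z in ball (0 : Eucl d) 1, w (z, y) := by
        rw [← integral_const_mul]
        congr with y
        simp only [w]
        rw [hρ.duchonRobert_eq, integral_const_mul]
        ring
    _ = 1 / 4 * ∫ z in ball (0 : Eucl d) 1, ∫ y, w (z, y) := by
        rw [integral_integral_swap (f := fun z y => w (z, y)) hint]
    _ = _ := by
        congr 1
        refine setIntegral_congr_fun measurableSet_ball fun z hz => ?_
        have hi : Integrable fun y => φ y • cubicIncrement v ε z y :=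
          integrable_smul_of_support_subset hφ.1.aestronglyMeasurable
            (measurable_cubicIncrement hv ε z).aestronglyMeasurable hB (subset_tsupport φ)
            ((hC z hz).trans_lt hCt.lt_top)
        rw [← integral_inner hi]
        simp only [w, inner_smul_right]

/-- After Fubini, dominated convergence in `z` applies: the uniform `L¹` bound gives a constant
majorant on the ball. -/
theorem IsKernel.tendsto_integral_mul_duchonRobert (hρ : IsKernel ρ) (hv : Measurable v)
    {U : Set (Eucl d × ℝ)} {φ : Eucl d × ℝ → ℝ} (hφ : IsTestFunction U φ) {C : ℝ≥0∞} (hCt : C ≠ ⊤)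
    {e : ℕ → ℝ} (hC : ∀ᶠ n in atTop, ∀ z ∈ ball (0 : Eucl d) 1,
      ∫⁻ y in tsupport φ, ‖cubicIncrement v (e n) z y‖ₑ ≤ C) {L : Eucl d → Eucl d}
    (hL : ∀ z ∈ ball (0 : Eucl d) 1,
      Tendsto (fun n => ∫ y, φ y • cubicIncrement v (e n) z y) atTop (𝓝 (L z))) :
    Tendsto (fun n => ∫ y, φ y * duchonRobert ρ v (e n) y) atTop
      (𝓝 (1 / 4 * ∫ z in ball (0 : Eucl d) 1, inner ℝ (gradient ρ z) (L z))) := by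
  obtain ⟨G, hG0, hG⟩ := hρ.exists_norm_gradient_le
  obtain ⟨B, hB0, hB⟩ := hφ.exists_bound
  have hlim : Tendsto (fun n => ∫ z in ball (0 : Eucl d) 1,
      inner ℝ (gradient ρ z) (∫ y, φ y • cubicIncrement v (e n) z y)) atTop
      (𝓝 (∫ z in ball (0 : Eucl d) 1, inner ℝ (gradient ρ z) (L z))) := by
    refine tendsto_integral_filter_of_dominated_convergence (fun _ => G * (B * C.toReal)) ?_ ?_
      ((integrableOn_const measure_ball_lt_top.ne)) ?_
    · refine Eventually.of_forall fun n => ?_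
      have hm : Measurable fun p : Eucl d × Eucl d × ℝ => φ p.2 • cubicIncrement v (e n) p.1 p.2 :=
        (hφ.1.measurable.comp measurable_snd).smul (measurable_cubicIncrement_uncurry hv _)
      exact (hρ.continuous_gradient.stronglyMeasurable.inner
        hm.stronglyMeasurable.integral_prod_right').aestronglyMeasurable
    · filter_upwards [hC] with n hn
      filter_upwards [ae_restrict_mem measurableSet_ball] with z hz
      refine (norm_inner_le_norm _ _).trans (mul_le_mul (hG z) ?_ (norm_nonneg _) hG0)
      exact norm_integral_smul_le_of_support_subset
        (measurable_cubicIncrement hv _ z).aestronglyMeasurable hCt hB0 hB (subset_tsupport φ)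
        (hn z hz)
    · filter_upwards [ae_restrict_mem measurableSet_ball] with z hz
      exact tendsto_const_nhds.inner (hL z hz)
  refine (hlim.const_mul (1 / 4)).congr' ?_
  filter_upwards [hC] with n hn
  exact (hρ.integral_mul_duchonRobert hv hφ hCt hn).symm

/-- Modifying the field on a null set does not affect the approximations inside `Q`. -/
theorem IsKernel.integral_mul_duchonRobert_congr (hρ : IsKernel ρ) {Q : Set (Eucl d × ℝ)}
    (hQ : MeasurableSet Q) {u : Eucl d × ℝ → Eucl d} (huv : u =ᵐ[volume.restrict Q] v)
    {φ : Eucl d × ℝ → ℝ} (hε : 0 ≤ ε) {δ : ℝ} (hεδ : ε < δ)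
    (hδ : ∀ y ∈ tsupport φ, ∀ a : Eucl d, ‖a‖ < δ → (y.1 + a, y.2) ∈ Q) :
    ∫ y, φ y * duchonRobert ρ u ε y = ∫ y, φ y * duchonRobert ρ v ε y := by
  have h0 : volume {y | ¬ (y ∈ Q → u y = v y)} = 0 := (ae_restrict_iff' hQ).1 huv
  obtain ⟨N, hsub, hN, hN0⟩ := exists_measurable_superset_of_null h0
  have hout : ∀ y ∈ Q, y ∉ N → u y = v y := fun y hy hyN => by
    by_contra h
    exact hyN (hsub fun h' => h (h' hy))
  have hz : ∀ z : Eucl d, ∀ᵐ y : Eucl d × ℝ, (y.1 + ε • z, y.2) ∉ N := fun z =>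
    (measurePreserving_space_translate (ε • z)).quasiMeasurePreserving.ae
      (p := fun y => y ∉ N) (by simpa [ae_iff] using hN0)
  -- For each `z` almost every `y` is good; Fubini exchanges the quantifiers. This is why the
  -- exceptional set was enlarged to a measurable null set `N`.
  have hswap : ∀ᵐ y : Eucl d × ℝ, ∀ᵐ z : Eucl d, (y.1 + ε • z, y.2) ∉ N := by
    refine (Measure.ae_ae_comm ?_).1 (Eventually.of_forall hz)
    have : Measurable fun p : Eucl d × Eucl d × ℝ => (p.2.1 + ε • p.1, p.2.2) := by fun_prop
    exact (this hN).compl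
  refine integral_congr_ae ?_
  filter_upwards [hswap, show ∀ᵐ y, y ∉ N by simpa [ae_iff] using hN0] with y hy hyN
  by_cases hφ : y ∈ tsupport φ
  swap
  · simp [image_eq_zero_of_notMem_tsupport hφ]
  have hyQ : y ∈ Q := by simpa using hδ y hφ 0 (by simpa using hε.trans_lt hεδ)
  rw [hρ.duchonRobert_eq, hρ.duchonRobert_eq]
  congr 2
  refine integral_congr_ae ?_
  filter_upwards [ae_restrict_of_ae hy, ae_restrict_mem measurableSet_ball] with z hzN hzb
  have hzQ : (y.1 + ε • z, y.2) ∈ Q := hδ y hφ _ (by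
    rw [norm_smul, Real.norm_of_nonneg hε]
    exact (mul_le_of_le_one_right hε (mem_ball_zero_iff.1 hzb).le).trans_lt hεδ)
  simp only [cubicIncrement, increment, hout y hyQ hyN, hout _ hzQ hzN]

end DuchonRobert

/-! ### Construction of the family `μ_z` -/

section OnsagerMeasure

variable {d : ℕ} {v : Eucl d × ℝ → Eucl d} {Q : Set (Eucl d × ℝ)}

@[simp]
theorem cubicIncrement_zero (v : Eucl d × ℝ → Eucl d) (ε : ℝ) (y : Eucl d × ℝ) :
    cubicIncrement v ε 0 y = 0 := by
  simp [cubicIncrement, increment]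

theorem CubicHolder.exists_bound {K : Set (Eucl d × ℝ)} {α β : ℝ} (h : CubicHolder v K α β)
    (hβ : 0 ≤ β) : ∃ C : ℝ, 0 < C ∧ ∃ δ : ℝ, 0 < δ ∧ ∀ ε, 0 < ε → ε < δ →
      ∀ z₁ ∈ closedBall (0 : Eucl d) 1, ∀ z₂ ∈ closedBall (0 : Eucl d) 1,
        ∫⁻ y in K, ‖cubicIncrement v ε z₁ y - cubicIncrement v ε z₂ y‖ₑ ≤
          ENNReal.ofReal (C * ‖z₁ - z₂‖ ^ α) := by
  obtain ⟨C, hC, δ, hδ, h⟩ := h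
  refine ⟨C * 2, by positivity, δ, hδ, fun ε h0 h1 z₁ hz₁ z₂ hz₂ => ?_⟩
  refine (h ε h0 h1 z₁ hz₁ z₂ hz₂).trans (ENNReal.ofReal_le_ofReal ?_)
  have e₁ : ‖z₁‖ ^ β ≤ 1 := Real.rpow_le_one (norm_nonneg _) (by simpa using hz₁) hβ
  have e₂ : ‖z₂‖ ^ β ≤ 1 := Real.rpow_le_one (norm_nonneg _) (by simpa using hz₂) hβ
  calc C * ‖z₁ - z₂‖ ^ α * (‖z₁‖ ^ β + ‖z₂‖ ^ β) ≤ C * ‖z₁ - z₂‖ ^ α * 2 := by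
        gcongr; linarith
    _ = C * 2 * ‖z₁ - z₂‖ ^ α := by ring

/-- The cubic increment vanishes at `z = 0`, so the Hölder estimate against `0` is a uniform bound.
-/
theorem CubicHolder.exists_lintegral_le {K : Set (Eucl d × ℝ)} {α β : ℝ} (h : CubicHolder v K α β)
    (hα : 0 ≤ α) (hβ : 0 ≤ β) : ∃ C : ℝ≥0∞, C ≠ ⊤ ∧ ∃ δ : ℝ, 0 < δ ∧ ∀ ε, 0 < ε → ε < δ →
      ∀ z ∈ closedBall (0 : Eucl d) 1, ∫⁻ y in K, ‖cubicIncrement v ε z y‖ₑ ≤ C := by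
  obtain ⟨C, hC, δ, hδ, h⟩ := h.exists_bound hβ
  refine ⟨ENNReal.ofReal C, ENNReal.ofReal_ne_top, δ, hδ, fun ε h0 h1 z hz => ?_⟩
  have := h ε h0 h1 z hz 0 (by simp)
  simp only [cubicIncrement_zero, sub_zero] at this
  refine this.trans (ENNReal.ofReal_le_ofReal ?_)
  exact mul_le_of_le_one_right hC.le
    (Real.rpow_le_one (norm_nonneg _) (by simpa using hz) hα)

/-- A dimensional factor by which the mass of a vector measure is bounded by its components. -/
def frameConst (d : ℕ) : ℝ≥0∞ := 1 + ∑ j, ‖(euclFrame d).b j‖ₑ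

theorem frameConst_ne_top (d : ℕ) : frameConst d ≠ ⊤ :=
  ENNReal.add_ne_top.2 ⟨ENNReal.one_ne_top, ENNReal.sum_ne_top.2 fun _ _ => enorm_ne_top⟩

/-- `C` is a constant in the `L¹` Hölder estimate on a neighborhood of `K`, enlarged by the
dimensional factor needed to bound vector measures by their components. -/
def IsHolderConst (v : Eucl d × ℝ → Eucl d) (Q K : Set (Eucl d × ℝ)) (α β C : ℝ) : Prop :=
  ∃ L, IsCompact K ∧ L ⊆ Q ∧ K ⊆ interior L ∧ ∃ δ : ℝ, 0 < δ ∧ ∀ ε, 0 < ε → ε < δ →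
    ∀ z₁ ∈ closedBall (0 : Eucl d) 1, ∀ z₂ ∈ closedBall (0 : Eucl d) 1,
      frameConst d *
        ∫⁻ y in L, ‖cubicIncrement v ε z₁ y - cubicIncrement v ε z₂ y‖ₑ ≤
          ENNReal.ofReal (C * ‖z₁ - z₂‖ ^ α * (‖z₁‖ ^ β + ‖z₂‖ ^ β))

theorem exists_isHolderConst (hQ : IsOpen Q) {α β : ℝ}
    (h : ∀ L, IsCompact L → L ⊆ Q → CubicHolder v L α β) {K : Set (Eucl d × ℝ)} (hK : IsCompact K)
    (hKQ : K ⊆ Q) : ∃ C, 0 < C ∧ IsHolderConst v Q K α β C := by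
  obtain ⟨L, hL, hKL, hLQ⟩ := exists_compact_between hK hQ hKQ
  obtain ⟨C, hC, δ, hδ, h⟩ := h L hL hLQ
  have hAt : frameConst d ≠ ⊤ := frameConst_ne_top d
  generalize hA : frameConst d = A at hAt
  lift A to NNReal using hAt
  refine ⟨A * C + 1, by positivity, L, hK, hLQ, hKL, δ, hδ, fun ε h0 h1 z₁ hz₁ z₂ hz₂ => ?_⟩
  refine (mul_le_mul' le_rfl (h ε h0 h1 z₁ hz₁ z₂ hz₂)).trans ?_
  rw [hA, ← ENNReal.ofReal_coe_nnreal, ← ENNReal.ofReal_mul A.coe_nonneg]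
  refine ENNReal.ofReal_le_ofReal ?_
  have hX : 0 ≤ ‖z₁ - z₂‖ ^ α * (‖z₁‖ ^ β + ‖z₂‖ ^ β) := by positivity
  linear_combination hX

/-- The zero measure represents the weak limit of the zero densities. -/
def FrameLimit.zero {X F κ ι : Type*} [TopologicalSpace X] [T2Space X] [MeasurableSpace X]
    [BorelSpace X] [NormedAddCommGroup F] [NormedSpace ℝ F] [CompleteSpace F] [Fintype ι]
    (P : PositiveFrame ι F) (U : Set X) (m : Measure X) (l : Filter κ) :
    FrameLimit P U m l (fun _ _ => 0) 0 where
  ν _ := 0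
  weakLimit j :=
    { lt_top := by simp
      tendsto := fun φ _ => by simpa [P.zero] using tendsto_const_nhds }
  eq := by
    refine RadonVectorMeasure.ext (funext fun K => ?_)
    by_cases hK : IsCompact K ∧ K ⊆ U
    · rw [RadonVectorMeasure.ofMeasures_on _ _ _ hK.1 hK.2]
      refine (Finset.sum_eq_zero fun j _ => ?_).symm
      ext A hA
      rw [withDensityᵥ_apply (by simp) hA]
      simp
    · rw [RadonVectorMeasure.on_eq_zero _ K hK, RadonVectorMeasure.on_eq_zero _ K hK]

/-- The family `μ_z` built from the weak limits of the cubic increments along a subsequence. -/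
structure OnsagerFamily (v : Eucl d × ℝ → Eucl d) (Q : Set (Eucl d × ℝ)) (ε : ℕ → ℝ)
    (μ : Eucl d → RadonVectorMeasure Q (Eucl d)) : Prop where
  tendsto : ∀ z ∈ closedBall (0 : Eucl d) 1, ∀ φ, IsTestFunction Q φ →
    Tendsto (fun n => ∫ y, φ y • cubicIncrement v (ε n) z y) atTop (𝓝 ((μ z).pairing φ))
  mass_le : ∀ K α β C, IsHolderConst v Q K α β C → ∀ z₁ ∈ closedBall (0 : Eucl d) 1,
    ∀ z₂ ∈ closedBall (0 : Eucl d) 1, (μ z₁ - μ z₂).mass K ≤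
      ENNReal.ofReal (C * ‖z₁ - z₂‖ ^ α * (‖z₁‖ ^ β + ‖z₂‖ ^ β))
  zero : μ 0 = 0

theorem exists_onsagerFamily (hQ : IsOpen Q) (hv : Measurable v)
    (hH : ∀ K, IsCompact K → K ⊆ Q → ∃ α β, 0 < α ∧ 0 ≤ β ∧ CubicHolder v K α β) {ε : ℕ → ℝ}
    (hε : ∀ n, 0 < ε n) (hε0 : Tendsto ε atTop (𝓝 0)) :
    ∃ k : ℕ → ℕ, StrictMono k ∧ ∃ μ, OnsagerFamily v Q (fun n => ε (k n)) μ := by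
  have hm : ∀ (e : ℝ) z, AEStronglyMeasurable (cubicIncrement v e z) volume := fun e z =>
    (measurable_cubicIncrement hv e z).aestronglyMeasurable
  have hbdd : ∀ {e : ℕ → ℝ}, (∀ n, 0 < e n) → Tendsto e atTop (𝓝 0) →
      ∀ z ∈ closedBall (0 : Eucl d) 1, LocBddL1 Q volume atTop fun n => cubicIncrement v (e n) z := by
    intro e he he0 z hz K hK hKQ
    obtain ⟨α, β, hα, hβ, h⟩ := hH K hK hKQ
    obtain ⟨C, hC, δ, hδ, h⟩ := h.exists_lintegral_le hα.le hβ
    exact ⟨C, hC, (he0.eventually_lt_const hδ).mono fun n hn => h _ (he n) hn z hz⟩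
  obtain ⟨k, hk, hlim⟩ := exists_subseq_integral_smul_tendsto hQ
    (g := fun n (z : closedBall (0 : Eucl d) 1) => cubicIncrement v (ε n) z) (m := volume)
    (fun n z => hm _ _) (fun z => hbdd hε hε0 z z.2) (by
      intro K hK hKQ z η hη
      obtain ⟨α, β, hα, hβ, h⟩ := hH K hK hKQ
      obtain ⟨C, hC, δ, hδ, h⟩ := h.exists_bound hβ
      have hcont : Tendsto (fun z' : closedBall (0 : Eucl d) 1 => C * ‖(z : Eucl d) - z'‖ ^ α)
          (𝓝 z) (𝓝 0) := by
        have : Continuous fun z' : closedBall (0 : Eucl d) 1 => C * ‖(z : Eucl d) - z'‖ ^ α :=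
          continuous_const.mul ((continuous_const.sub continuous_subtype_val).norm.rpow_const
            fun _ => Or.inr hα.le)
        simpa [Real.zero_rpow hα.ne'] using this.tendsto z
      filter_upwards [hcont.eventually_lt_const hη] with z' hz'
      filter_upwards [hε0.eventually_lt_const hδ] with n hn
      exact (h _ (hε n) hn z z.2 z' z'.2).trans (ENNReal.ofReal_le_ofReal hz'.le))
  have hεk : Tendsto (fun n => ε (k n)) atTop (𝓝 0) := hε0.comp hk.tendsto_atTop
  -- The pairings already converge along the subsequence. The ultrafilter only serves to represent
  -- their limits by measures and to compare these; uniqueness of limits then gives convergence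
  -- along `atTop`.
  let l : Ultrafilter ℕ := Ultrafilter.of atTop
  have hl : (l : Filter ℕ) ≤ atTop := Ultrafilter.of_le _
  have hbl : ∀ z ∈ closedBall (0 : Eucl d) 1,
      LocBddL1 Q volume l fun n => cubicIncrement v (ε (k n)) z := fun z hz K hK hKQ => by
    obtain ⟨C, hC, h⟩ := hbdd (fun n => hε (k n)) hεk z hz K hK hKQ
    exact ⟨C, hC, h.filter_mono hl⟩
  have hex : ∀ z, ∃ μ : RadonVectorMeasure Q (Eucl d), (z ∈ closedBall (0 : Eucl d) 1 →
      Nonempty (FrameLimit (euclFrame d) Q volume (l : Filter ℕ)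
        (fun n => cubicIncrement v (ε (k n)) z) μ)) ∧ (z = 0 → μ = 0) := fun z => by
    by_cases hz : z ∈ closedBall (0 : Eucl d) 1
    -- At the origin the zero measure itself is chosen, so that `μ 0 = 0` is an equality and the
    -- mass estimate still applies. Outside the ball zero is a default value.
    · rcases eq_or_ne z 0 with rfl | hz0
      · refine ⟨0, fun _ => ⟨?_⟩, fun _ => rfl⟩
        have h0 : (fun n => cubicIncrement v (ε (k n)) (0 : Eucl d)) = fun _ _ => 0 := by
          funext n y
          simp
        rw [h0]
        exact FrameLimit.zero _ _ _ _
      · obtain ⟨μ, hμ⟩ := (hbl z hz).exists_frameLimit (euclFrame d) hQ l fun n => hm _ z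
        exact ⟨μ, fun _ => hμ, fun h => absurd h hz0⟩
    · exact ⟨0, fun h => absurd h hz, fun _ => rfl⟩
  choose μ hμ hμ0 using hex
  refine ⟨k, hk, μ, ⟨fun z hz φ hφ => ?_, ?_, hμ0 0 rfl⟩⟩
  · obtain ⟨L, hL⟩ := hlim ⟨z, hz⟩ φ hφ
    obtain ⟨F⟩ := hμ z hz
    rwa [tendsto_nhds_unique (F.tendsto (hbl z hz) (fun n => hm _ z) hφ) (hL.mono_left hl)]
  · rintro K α β C ⟨L, hK, hLQ, hKL, δ, hδ, h⟩ z₁ hz₁ z₂ hz₂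
    obtain ⟨F₁⟩ := hμ z₁ hz₁
    obtain ⟨F₂⟩ := hμ z₂ hz₂
    have hA0 : frameConst d ≠ 0 := by simp [frameConst]
    -- The dimensional loss in `FrameLimit.mass_sub_le` was built into `IsHolderConst`: dividing by
    -- `frameConst d`, which is nonzero thanks to its summand `1`, compensates it.
    set R := ENNReal.ofReal (C * ‖z₁ - z₂‖ ^ α * (‖z₁‖ ^ β + ‖z₂‖ ^ β))
    refine (F₁.mass_sub_le hQ F₂ (hbl z₁ hz₁) (hbl z₂ hz₂) (fun n => hm _ z₁) (fun n => hm _ z₂)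
      hK hLQ hKL (C := R / frameConst d) ?_).trans ?_
    · refine Eventually.filter_mono hl ?_
      filter_upwards [hεk.eventually_lt_const hδ] with n hn
      rw [ENNReal.le_div_iff_mul_le (Or.inl hA0) (Or.inl (frameConst_ne_top d)), mul_comm]
      exact h _ (hε _) hn z₁ hz₁ z₂ hz₂
    · exact (mul_le_mul' le_add_self le_rfl).trans ENNReal.mul_div_le

end OnsagerMeasure

/-! ### Weak limits of the approximations along the subsequence -/

section WeakLimitFormula

variable {d : ℕ} {ρ : Eucl d → ℝ} {v : Eucl d × ℝ → Eucl d} {Q : Set (Eucl d × ℝ)} {α β : ℝ}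
  {e : ℕ → ℝ}

theorem IsKernel.tendsto_integral_mul_duchonRobert_onsagerFamily (hρ : IsKernel ρ)
    (hv : Measurable v) (hα : 0 ≤ α) (hβ : 0 ≤ β)
    (hH : ∀ K, IsCompact K → K ⊆ Q → CubicHolder v K α β) (he : ∀ n, 0 < e n)
    (he0 : Tendsto e atTop (𝓝 0)) {μ : Eucl d → RadonVectorMeasure Q (Eucl d)}
    (hμ : OnsagerFamily v Q e μ) {φ : Eucl d × ℝ → ℝ} (hφ : IsTestFunction Q φ) :
    Tendsto (fun n => ∫ y, φ y * duchonRobert ρ v (e n) y) atTop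
      (𝓝 (1 / 4 * kernelIntegral ρ μ φ)) := by
  obtain ⟨C, hC, δ, hδ, h⟩ := (hH _ hφ.2.1 hφ.2.2).exists_lintegral_le hα hβ
  refine hρ.tendsto_integral_mul_duchonRobert hv hφ hC ?_
    fun z hz => hμ.tendsto z (ball_subset_closedBall hz) φ hφ
  exact (he0.eventually_lt_const hδ).mono fun n hn z hz =>
    h _ (he n) hn z (ball_subset_closedBall hz)

/-- An ultrafilter limit of the approximations is a measure, and its pairings must be the given
limits `Λ φ`. -/
theorem IsKernel.exists_radonVectorMeasure (hρ : IsKernel ρ) (hQ : IsOpen Q)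
    (hv : Measurable v) (hα : 0 ≤ α) (hβ : 0 ≤ β)
    (hH : ∀ K, IsCompact K → K ⊆ Q → CubicHolder v K α β) (he : ∀ n, 0 < e n)
    (he0 : Tendsto e atTop (𝓝 0)) {Λ : (Eucl d × ℝ → ℝ) → ℝ}
    (hΛ : ∀ φ, IsTestFunction Q φ →
      Tendsto (fun n => ∫ y, φ y * duchonRobert ρ v (e n) y) atTop (𝓝 (Λ φ))) :
    ∃ D : RadonVectorMeasure Q ℝ, ∀ φ, IsTestFunction Q φ → D.pairing φ = Λ φ := by
  let l : Ultrafilter ℕ := Ultrafilter.of atTop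
  have hl : (l : Filter ℕ) ≤ atTop := Ultrafilter.of_le _
  have hm : ∀ n, AEStronglyMeasurable (duchonRobert ρ v (e n)) volume := fun n =>
    (hρ.stronglyMeasurable_duchonRobert hv _).aestronglyMeasurable
  obtain ⟨G, -, hG⟩ := hρ.exists_norm_gradient_le
  have hb : LocBddL1 Q volume (l : Filter ℕ) fun n => duchonRobert ρ v (e n) := by
    intro K hK hKQ
    obtain ⟨C, hC, δ, hδ, h⟩ := (hH K hK hKQ).exists_lintegral_le hα hβ
    refine ⟨ENNReal.ofReal G * C * volume (ball (0 : Eucl d) 1), ENNReal.mul_ne_top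
      (ENNReal.mul_ne_top ENNReal.ofReal_ne_top hC) measure_ball_lt_top.ne, ?_⟩
    exact ((he0.eventually_lt_const hδ).mono fun n hn =>
      hρ.lintegral_duchonRobert_le hv hG fun z hz =>
        h _ (he n) hn z (ball_subset_closedBall hz)).filter_mono hl
  obtain ⟨D, ⟨F⟩⟩ := hb.exists_frameLimit realFrame hQ l hm
  refine ⟨D, fun φ hφ => tendsto_nhds_unique (F.tendsto hb hm hφ) ?_⟩
  exact (hΛ φ hφ).mono_left hl

end WeakLimitFormula

end

/-! ### The main theorem -/

theorem theorem1p1 (d : ℕ) (Ω : Set (Eucl d)) (hΩ : IsOpen Ω) (T : ℝ)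
    (u : Eucl d × ℝ → Eucl d)
    (hmeas : AEStronglyMeasurable u (volume.restrict (Ω ×ˢ Ioo 0 T)))
    (hu : (∃ p : ℝ, 1 < p ∧ BesovClass Ω T p u) ∨ HalfClass Ω T u ∨ BVClass Ω T u) :
    -- the constants of the Hölder estimates depend only on `u` and `K` (and on `p`)
    ∃ (C₁ : ℝ → Set (Eucl d × ℝ) → ℝ) (C₂ C₃ : Set (Eucl d × ℝ) → ℝ),
      (∀ p K, 0 < C₁ p K) ∧ (∀ K, 0 < C₂ K) ∧ (∀ K, 0 < C₃ K) ∧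
      ∀ ε : ℕ → ℝ, (∀ n, 0 < ε n) → Tendsto ε atTop (𝓝 0) →
      -- the family `μ_z` is meaningful for `z` in the closed unit ball
      ∃ μ : Eucl d → RadonVectorMeasure (Ω ×ˢ Ioo 0 T) (Eucl d),
        -- continuity in `z`, in the total variation norm on every compact set
        (∀ K : Set (Eucl d × ℝ), IsCompact K → K ⊆ Ω ×ˢ Ioo 0 T →
          ∀ z₀ ∈ closedBall (0 : Eucl d) 1,
            Tendsto (fun z => (μ z - μ z₀).mass K) (𝓝[closedBall 0 1] z₀) (𝓝 0)) ∧
        -- the formula for every weak limit along `ε n`, with `μ` independent of the kernel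
        (∀ ρ : Eucl d → ℝ, IsKernel ρ → ∀ D : RadonVectorMeasure (Ω ×ˢ Ioo 0 T) ℝ,
          WeaklyConverges (fun n => duchonRobert ρ u (ε n)) D →
          ∀ φ, IsTestFunction (Ω ×ˢ Ioo 0 T) φ →
            D.pairing φ = 1 / 4 * kernelIntegral ρ μ φ) ∧
        -- along a subsequence which is the same for all kernels, all the limits exist
        (∃ k : ℕ → ℕ, StrictMono k ∧ ∀ ρ : Eucl d → ℝ, IsKernel ρ →
          ∃ D : RadonVectorMeasure (Ω ×ˢ Ioo 0 T) ℝ,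
            WeaklyConverges (fun n => duchonRobert ρ u (ε (k n))) D ∧
            ∀ φ, IsTestFunction (Ω ×ˢ Ioo 0 T) φ →
              D.pairing φ = 1 / 4 * kernelIntegral ρ μ φ) ∧
        -- the infimum formula for limits that do not depend on the kernel
        (∀ D : RadonVectorMeasure (Ω ×ˢ Ioo 0 T) ℝ,
          (∀ ρ : Eucl d → ℝ, IsKernel ρ →
            WeaklyConverges (fun n => duchonRobert ρ u (ε n)) D) →
          ∀ φ, IsTestFunction (Ω ×ˢ Ioo 0 T) φ →
            IsGLB {r : ℝ | ∃ ρ : Eucl d → ℝ, IsKernel ρ ∧ r = 1 / 4 * |kernelIntegral ρ μ φ|}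
              |D.pairing φ|) ∧
        -- (i) Hölder continuity in the three cases
        (∀ p : ℝ, 1 < p → BesovClass Ω T p u →
          ∀ K : Set (Eucl d × ℝ), IsCompact K → K ⊆ Ω ×ˢ Ioo 0 T →
          ∀ z₁ ∈ closedBall (0 : Eucl d) 1, ∀ z₂ ∈ closedBall (0 : Eucl d) 1,
            (μ z₁ - μ z₂).mass K ≤ ENNReal.ofReal (C₁ p K *
              ‖z₁ - z₂‖ ^ max (1 / p) (1 / (2 * conjExp p)) *
              (‖z₁‖ ^ min (1 / conjExp p) ((p + 1) / (2 * p)) +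
                ‖z₂‖ ^ min (1 / conjExp p) ((p + 1) / (2 * p))))) ∧
        (HalfClass Ω T u →
          ∀ K : Set (Eucl d × ℝ), IsCompact K → K ⊆ Ω ×ˢ Ioo 0 T →
          ∀ z₁ ∈ closedBall (0 : Eucl d) 1, ∀ z₂ ∈ closedBall (0 : Eucl d) 1,
            (μ z₁ - μ z₂).mass K ≤ ENNReal.ofReal (C₂ K * ‖z₁ - z₂‖ ^ (1 / 2 : ℝ) *
              (‖z₁‖ ^ (1 / 2 : ℝ) + ‖z₂‖ ^ (1 / 2 : ℝ)))) ∧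
        (BVClass Ω T u →
          ∀ K : Set (Eucl d × ℝ), IsCompact K → K ⊆ Ω ×ˢ Ioo 0 T →
          ∀ z₁ ∈ closedBall (0 : Eucl d) 1, ∀ z₂ ∈ closedBall (0 : Eucl d) 1,
            (μ z₁ - μ z₂).mass K ≤ ENNReal.ofReal (C₃ K * ‖z₁ - z₂‖)) ∧
        -- (ii) vanishing at the origin
        μ 0 = 0 ∧
        -- (iii) oddness
        (∀ ρ : Eucl d → ℝ, IsKernel ρ → ∀ φ, IsTestFunction (Ω ×ˢ Ioo 0 T) φ →
          kernelIntegral ρ (fun z => μ (-z)) φ = -kernelIntegral ρ μ φ) := by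
  have hQ : IsOpen (Ω ×ˢ Ioo 0 T) := hΩ.prod isOpen_Ioo
  set Q : Set (Eucl d × ℝ) := Ω ×ˢ Ioo 0 T with hQdef
  let v := hmeas.mk u
  have hv : Measurable v := hmeas.stronglyMeasurable_mk.measurable
  have huv : u =ᵐ[volume.restrict Q] v := hmeas.ae_eq_mk
  -- The constants are fixed before the sequence `ε`, since `IsHolderConst` involves only `v`, `Q`,
  -- `K` and the exponents. The value `1` is a default where the assumptions fail.
  have hc₁ : ∀ (p : ℝ) (K : Set (Eucl d × ℝ)), ∃ C : ℝ, 0 < C ∧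
      (1 < p → BesovClass Ω T p u → IsCompact K → K ⊆ Q →
        IsHolderConst v Q K (max (1 / p) (1 / (2 * conjExp p)))
          (min (1 / conjExp p) ((p + 1) / (2 * p))) C) := fun p K => by
    by_cases h : 1 < p ∧ BesovClass Ω T p u ∧ IsCompact K ∧ K ⊆ Q
    · obtain ⟨C, hC, hC'⟩ := exists_isHolderConst hQ
        (fun L hL hLQ => h.2.1.cubicHolder hΩ hv huv h.1 hL hLQ) h.2.2.1 h.2.2.2
      exact ⟨C, hC, fun _ _ _ _ => hC'⟩
    · exact ⟨1, one_pos, fun h1 h2 h3 h4 => absurd ⟨h1, h2, h3, h4⟩ h⟩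
  have hc₂ : ∀ K : Set (Eucl d × ℝ), ∃ C : ℝ, 0 < C ∧
      (HalfClass Ω T u → IsCompact K → K ⊆ Q → IsHolderConst v Q K (1 / 2) (1 / 2) C) := fun K => by
    by_cases h : HalfClass Ω T u ∧ IsCompact K ∧ K ⊆ Q
    · obtain ⟨C, hC, hC'⟩ := exists_isHolderConst hQ
        (fun L hL hLQ => h.1.cubicHolder hΩ hv huv hL hLQ) h.2.1 h.2.2
      exact ⟨C, hC, fun _ _ _ => hC'⟩
    · exact ⟨1, one_pos, fun h1 h2 h3 => absurd ⟨h1, h2, h3⟩ h⟩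
  have hc₃ : ∀ K : Set (Eucl d × ℝ), ∃ C : ℝ, 0 < C ∧
      (BVClass Ω T u → IsCompact K → K ⊆ Q → IsHolderConst v Q K 1 0 C) := fun K => by
    by_cases h : BVClass Ω T u ∧ IsCompact K ∧ K ⊆ Q
    · obtain ⟨C, hC, hC'⟩ := exists_isHolderConst hQ
        (fun L hL hLQ => h.1.cubicHolder hΩ hv huv hL hLQ) h.2.1 h.2.2
      exact ⟨C, hC, fun _ _ _ => hC'⟩
    · exact ⟨1, one_pos, fun h1 h2 h3 => absurd ⟨h1, h2, h3⟩ h⟩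
  choose C₁ hC₁0 hC₁ using hc₁
  choose C₂ hC₂0 hC₂ using hc₂
  choose C₃ hC₃0 hC₃ using hc₃
  -- Any one class suffices to construct `μ`. If several hold, the same `μ` satisfies all their
  -- estimates, because `OnsagerFamily.mass_le` accepts every admissible constant and pair of
  -- exponents.
  obtain ⟨α, β, hα, hβ, hH⟩ : ∃ α β : ℝ, 0 < α ∧ 0 ≤ β ∧
      ∀ K, IsCompact K → K ⊆ Q → CubicHolder v K α β := by
    rcases hu with ⟨p, hp, h⟩ | h | h
    · have hp0 : 0 < p := by linarith
      have hc : 0 < conjExp p := div_pos hp0 (by linarith)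
      exact ⟨_, _, lt_max_of_lt_left (by positivity), le_min (by positivity) (by positivity),
        fun K hK hKQ => h.cubicHolder hΩ hv huv hp hK hKQ⟩
    · exact ⟨1 / 2, 1 / 2, by norm_num, by norm_num,
        fun K hK hKQ => h.cubicHolder hΩ hv huv hK hKQ⟩
    · exact ⟨1, 0, by norm_num, le_rfl, fun K hK hKQ => h.cubicHolder hΩ hv huv hK hKQ⟩
  -- For `BV` the exponent `β` is `0`, and `‖z₁‖ ^ 0 + ‖z₂‖ ^ 0 = 2`, also at the origin.
  refine ⟨C₁, C₂, fun K => 2 * C₃ K, hC₁0, hC₂0, fun K => mul_pos two_pos (hC₃0 K),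
    fun ε hε hε0 => ?_⟩
  obtain ⟨k, hk, μ, hμ⟩ := exists_onsagerFamily hQ hv
    (fun K hK hKQ => ⟨α, β, hα, hβ, hH K hK hKQ⟩) hε hε0
  have hεk : Tendsto (fun n => ε (k n)) atTop (𝓝 0) := hε0.comp hk.tendsto_atTop
  have hlimv : ∀ ρ : Eucl d → ℝ, IsKernel ρ → ∀ φ, IsTestFunction Q φ →
      Tendsto (fun n => ∫ y, φ y * duchonRobert ρ v (ε (k n)) y) atTop
        (𝓝 (1 / 4 * kernelIntegral ρ μ φ)) := fun ρ hρ φ hφ =>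
    hρ.tendsto_integral_mul_duchonRobert_onsagerFamily hv hα.le hβ hH (fun n => hε (k n)) hεk
      hμ hφ
  have hlim : ∀ ρ : Eucl d → ℝ, IsKernel ρ → ∀ φ, IsTestFunction Q φ →
      Tendsto (fun n => ∫ y, φ y * duchonRobert ρ u (ε (k n)) y) atTop
        (𝓝 (1 / 4 * kernelIntegral ρ μ φ)) := fun ρ hρ φ hφ => by
    refine (hlimv ρ hρ φ hφ).congr' ?_
    obtain ⟨δ, hδ, hδQ⟩ := hφ.2.1.exists_thickening_subset_open hQ hφ.2.2
    filter_upwards [hεk.eventually_lt_const hδ] with n hn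
    refine (hρ.integral_mul_duchonRobert_congr hQ.measurableSet huv (hε _).le hn ?_).symm
    intro y hy a ha
    refine hδQ (mem_thickening_iff.2 ⟨y, hy, ?_⟩)
    rw [Prod.dist_eq, max_lt_iff]
    exact ⟨by simpa [dist_eq_norm] using ha, by simpa using hδ⟩
  have hformula : ∀ ρ : Eucl d → ℝ, IsKernel ρ → ∀ D : RadonVectorMeasure Q ℝ,
      WeaklyConverges (fun n => duchonRobert ρ u (ε n)) D → ∀ φ, IsTestFunction Q φ →
        D.pairing φ = 1 / 4 * kernelIntegral ρ μ φ := fun ρ hρ D hD φ hφ =>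
    tendsto_nhds_unique ((hD φ hφ).comp hk.tendsto_atTop) (hlim ρ hρ φ hφ)
  refine ⟨μ, ?_, hformula, ⟨k, hk, fun ρ hρ => ?_⟩, ?_, ?_, ?_, ?_, hμ.zero, ?_⟩
  · intro K hK hKQ z₀ hz₀
    obtain ⟨C, -, hC⟩ := exists_isHolderConst hQ hH hK hKQ
    have hlim0 : Tendsto (fun z => ENNReal.ofReal
        (C * ‖z - z₀‖ ^ α * (‖z‖ ^ β + ‖z₀‖ ^ β))) (𝓝[closedBall 0 1] z₀) (𝓝 0) := by
      have hcont : Continuous fun z : Eucl d => ENNReal.ofReal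
          (C * ‖z - z₀‖ ^ α * (‖z‖ ^ β + ‖z₀‖ ^ β)) :=
        ENNReal.continuous_ofReal.comp <| (continuous_const.mul
          ((continuous_id.sub continuous_const).norm.rpow_const fun _ => Or.inr hα.le)).mul
          ((continuous_norm.rpow_const fun _ => Or.inr hβ).add continuous_const)
      refine tendsto_nhdsWithin_of_tendsto_nhds ?_
      simpa [Real.zero_rpow hα.ne'] using hcont.tendsto z₀
    refine tendsto_of_tendsto_of_tendsto_of_le_of_le' tendsto_const_nhds hlim0
      (Eventually.of_forall fun _ => bot_le) ?_
    filter_upwards [self_mem_nhdsWithin] with z hz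
    exact hμ.mass_le K α β C hC z hz z₀ hz₀
  · obtain ⟨D, hD⟩ := hρ.exists_radonVectorMeasure hQ hv hα.le hβ hH (fun n => hε (k n)) hεk
      (hlimv ρ hρ)
    exact ⟨D, fun φ hφ => by rw [hD φ hφ]; exact hlim ρ hρ φ hφ, hD⟩
  · intro D hD φ hφ
    have habs : ∀ ρ : Eucl d → ℝ, IsKernel ρ →
        |D.pairing φ| = 1 / 4 * |kernelIntegral ρ μ φ| := fun ρ hρ => by
      rw [hformula ρ hρ D (hD ρ hρ) φ hφ, abs_mul, abs_of_pos (by norm_num : (0 : ℝ) < 1 / 4)]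
    -- All kernels give the same value, so one kernel is enough to show that it is the greatest
    -- lower bound.
    obtain ⟨ρ₀, hρ₀⟩ := exists_isKernel d
    refine ⟨?_, fun b hb => hb ⟨ρ₀, hρ₀, habs ρ₀ hρ₀⟩⟩
    rintro r ⟨ρ, hρ, rfl⟩
    exact (habs ρ hρ).le
  · intro p hp h K hK hKQ z₁ hz₁ z₂ hz₂
    exact hμ.mass_le K _ _ _ (hC₁ p K hp h hK hKQ) z₁ hz₁ z₂ hz₂
  · intro h K hK hKQ z₁ hz₁ z₂ hz₂
    exact hμ.mass_le K _ _ _ (hC₂ K h hK hKQ) z₁ hz₁ z₂ hz₂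
  · intro h K hK hKQ z₁ hz₁ z₂ hz₂
    refine (hμ.mass_le K _ _ _ (hC₃ K h hK hKQ) z₁ hz₁ z₂ hz₂).trans (le_of_eq ?_)
    congr 1
    simp only [Real.rpow_one, Real.rpow_zero]
    ring
  · intro ρ hρ φ _
    exact hρ.kernelIntegral_comp_neg μ φ
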